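/- Let $[Tf](x)=f(x-1)$ and $[Df](x)=2^{1/2}f(2x)$ on $L^2(\mathbb R)$. Let $\Psi$ be a finite or countable family in $L^2(\mathbb R)$ with $\sup_{\psi\in\Psi}\|\psi\|<\infty$, and let $X=\{\psi_{k,j}=D^kT^j\psi:\psi\in\Psi,\ k,j\in\mathbb Z\}$, a family indexed by the triples $(\psi,k,j)$. $X$ is a Bessel system if $\sum_{x\in X}|\langle f,x\rangle|^2\le B\|f\|^2$ for all $f\in L^2(\mathbb R)$ and some $B>0$; it is a frame if, moreover, $A\|f\|^2\le\sum_{x\in X}|\langle f,x\rangle|^2$ for all $f$ and some $A>0$; a frame is tight with frame bound $B$ if its sharpest constants $A$ and $B$ coincide and equal $B$. The frame operator is $Sf=\sum_{x\in X}\langle f,x\rangle x$; it is a well-defined bounded operator if this series converges unconditionally for every $f\in L^2(\mathbb R)$ and its sum is a bounded linear operator of $f$. Let $\mathbb J$ be a countable index set, let $(K_{+,j})_{j\in\mathbb J}$ and $(K_{-,j})_{j\in\mathbb J}$ be orthonormal bases of $L^2[1,2)$ and $L^2(-2,-1]$, extended by $0$ to $\mathbb R$, and let $(u_{s,j})_{s=\pm,\,j\in\mathbb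 J}$ be an orthonormal basis of $H=\ell^2(\mathbb J)\oplus\ell^2(\mathbb J)$. Let $\mathcal G:L^2(\mathbb R)\to L^2(\partial\mathbb D;H)$ be the unitary operator $$\mathcal Gf=\bigoplus_{s=\pm}\bigoplus_{j\in\mathbb J}\Big[\sum_{m\in\mathbb Z}\omega^m\langle f,D^mK_{s,j}\rangle\Big]u_{s,j},$$ where the unit circle $\partial\mathbb D$ carries normalized Lebesgue measure. A bounded operator $R$ on $L^2(\partial\mathbb D;H)$ is decomposable, written $R=R(\omega)$, if there are bounded operators $R(\omega)$ on $H$ ($\omega\in\partial\mathbb D$) such that for each $\mathbf v\in L^2(\partial\mathbb D;H)$ one has $R(\omega)\mathbf v(\omega)=[R\mathbf v](\omega)$ for a.e. $\omega$. For such a family put $$\alpha=\operatorname*{ess\,sup}_{\omega}\sup_{\|u\|_H=1}\|S(\omega)u\|,\qquad \beta=\operatorname*{ess\,inf}_{\omega}\inf_{\|u\|_H=1}\|S(\omega)u\|.$$ 1. $X$ is a Bessel system if and only if $S$ is a well-defined bounded operator on $L^2(\mathbb R)$. In that case $S$ commutes with $D$, and $\mathcal GS\mathcal G^{-1}=S(\omega)$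 is decomposable; $S$ is positive, $S(\omega)$ is positive for a.e. $\omega$, and $\|S\|=\operatorname{ess\,sup}_\omega\|S(\omega)\|=\alpha<\infty$. 2. $X$ is a frame if and only if $S$ is a well-defined bounded operator on $L^2(\mathbb R)$ with a bounded two-sided inverse $S^{-1}$. In that case $S^{-1}$ commutes with $D$, $S(\omega)$ is invertible for a.e. $\omega$, and $\mathcal GS^{-1}\mathcal G^{-1}=S(\omega)^{-1}$. Equivalently, $X$ is a frame if and only if $S$ is a well-defined bounded operator whose fibers $S(\omega)$ satisfy $\alpha<\infty$ and $\beta>0$; in that case $\|S\|=\alpha$ and $\|S^{-1}\|=\beta^{-1}$. 3. For $B>0$, $X$ is a tight frame with frame bound $B$ if and only if $S=B\,I_{L^2(\mathbb R)}$ or, equivalently, $\mathcal GS\mathcal G^{-1}=B\,I_H$, i.e. it is decomposable with the constant fibers $B\,I_H$. -/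

import Mathlib

open MeasureTheory Set
open scoped ENNReal

noncomputable section

namespace WaveletFrame

/-! ### Bessel systems, frames and frame operators in a Hilbert space -/

section Frames

variable {H : Type*} [NormedAddCommGroup H] [InnerProductSpace ℂ H] {I : Type*}

/-- `A` is a lower frame bound: `A ‖f‖² ≤ ∑ᵢ |⟨f, xᵢ⟩|²` for all `f`, where `A > 0`.
The sum is taken in `[0, ∞]`, so that it always has a meaning. -/
def IsLowerBound (x : I → H) (A : ℝ) : Prop :=
  0 < A ∧ ∀ f : H, ENNReal.ofReal A * ‖f‖ₑ ^ 2 ≤ ∑' i, ‖inner ℂ (x i) f‖ₑ ^ 2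

/-- `B` is an upper frame bound (a Bessel bound): `∑ᵢ |⟨f, xᵢ⟩|² ≤ B ‖f‖²` for all `f`,
where `B > 0`. -/
def IsUpperBound (x : I → H) (B : ℝ) : Prop :=
  0 < B ∧ ∀ f : H, ∑' i, ‖inner ℂ (x i) f‖ₑ ^ 2 ≤ ENNReal.ofReal B * ‖f‖ₑ ^ 2

/-- Bessel systems. -/
def IsBessel (x : I → H) : Prop := ∃ B, IsUpperBound x B

/-- Frames. -/
def IsFrame (x : I → H) : Prop := (∃ A, IsLowerBound x A) ∧ ∃ B, IsUpperBound x B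

/-- Tight frames with frame bound `B`: frames for which the sharpest lower and upper frame
bounds both equal `B`. -/
def IsTightFrame (x : I → H) (B : ℝ) : Prop :=
  IsFrame x ∧ IsGreatest {A | IsLowerBound x A} B ∧ IsLeast {A | IsUpperBound x A} B

/-- The frame operator of `x` is the well-defined bounded operator `S`: for every `f` the series
`∑ᵢ ⟨f, xᵢ⟩ xᵢ` converges unconditionally, with sum `S f`. -/
def IsFrameOperator (x : I → H) (S : H →L[ℂ] H) : Prop :=
  ∀ f : H, HasSum (fun i => inner ℂ (x i) f • x i) (S f)

end Frames

/-! ### Translation and dilation on `L²(ℝ)`, wavelet systems -/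

/-- `L²(ℝ)`. -/
abbrev L2R : Type := Lp ℂ 2 (volume : Measure ℝ)

/-- The closed subspace `L²(s)` of `L²(ℝ)`: the functions that vanish a.e. outside `s`. -/
def L2On (s : Set ℝ) : Submodule ℂ L2R where
  carrier := {f | ∀ᵐ x, x ∉ s → f x = 0}
  zero_mem' := by
    filter_upwards [Lp.coeFn_zero ℂ 2 (volume : Measure ℝ)] with x hx _
    exact hx
  add_mem' := by
    intro f g hf hg
    filter_upwards [hf, hg, Lp.coeFn_add f g] with x h1 h2 h3 hx
    exact h3.trans (by simp [h1 hx, h2 hx])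
  smul_mem' := by
    intro c f hf
    filter_upwards [hf, Lp.coeFn_smul c f] with x h1 h2 hx
    exact h2.trans (by simp [h1 hx])

lemma compMP_surj {g h : ℝ → ℝ} (hg : MeasurePreserving g) (hh : MeasurePreserving h)
    (hgh : ∀ x, h (g x) = x) :
    Function.Surjective (Lp.compMeasurePreservingₗᵢ ℂ (E := ℂ) (p := 2) g hg) := by
  intro f
  refine ⟨Lp.compMeasurePreserving h hh f, ?_⟩
  change Lp.compMeasurePreserving g hg _ = f
  ext1
  filter_upwards [Lp.coeFn_compMeasurePreserving (Lp.compMeasurePreserving h hh f) hg,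
    hg.quasiMeasurePreserving.ae (Lp.coeFn_compMeasurePreserving f hh)] with x h1 h2
  rw [h1, Function.comp, h2, Function.comp, hgh]

/-- The translation operator `[T f](x) = f(x - 1)`. -/
def transOp : L2R ≃ₗᵢ[ℂ] L2R :=
  LinearIsometryEquiv.ofSurjective
    (Lp.compMeasurePreservingₗᵢ ℂ (fun x : ℝ => x - 1) (measurePreserving_sub_right volume 1))
    (compMP_surj _ (measurePreserving_add_right volume 1) (by simp))

lemma transOp_coe (f : L2R) : transOp f =ᵐ[volume] fun x => f (x - 1) :=
  Lp.coeFn_compMeasurePreserving f (measurePreserving_sub_right volume 1)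

lemma qmp_mul {a : ℝ} (ha : 0 < a) :
    Measure.QuasiMeasurePreserving (fun x : ℝ => a * x) volume volume := by
  refine ⟨by fun_prop, ?_⟩
  rw [Real.map_volume_mul_left ha.ne']
  exact Measure.smul_absolutelyContinuous

lemma eLpNorm_dil {a : ℝ} (ha : 0 < a) (f : L2R) :
    eLpNorm (fun x : ℝ => (Real.sqrt a : ℂ) * f (a * x)) 2 volume = eLpNorm f 2 volume := by
  have h1 : eLpNorm (fun x : ℝ => f (a * x)) 2 volume
      = ENNReal.ofReal (Real.sqrt a)⁻¹ * eLpNorm f 2 volume := by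
    have := eLpNorm_map_measure (μ := volume) (p := 2) (g := f) (f := fun x : ℝ => a * x)
      (by rw [Real.map_volume_mul_left ha.ne']
          exact (Lp.aestronglyMeasurable f).smul_measure _)
      (by fun_prop)
    rw [Function.comp_def] at this
    rw [← this, Real.map_volume_mul_left ha.ne',
      eLpNorm_smul_measure_of_ne_top (by simp), smul_eq_mul]
    congr 1
    rw [abs_of_pos (inv_pos.2 ha), ENNReal.ofReal_rpow_of_nonneg (inv_pos.2 ha).le (by simp),
      ← Real.sqrt_inv, Real.sqrt_eq_rpow]
    simp
  have h2 := eLpNorm_const_smul (Real.sqrt a : ℂ) (fun x : ℝ => f (a * x)) 2 volume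
  have h3 : ‖(Real.sqrt a : ℂ)‖ₑ = ENNReal.ofReal (Real.sqrt a) := by
    rw [← ofReal_norm, Complex.norm_real, Real.norm_of_nonneg (Real.sqrt_nonneg a)]
  have h4 : ((Real.sqrt a : ℂ) • fun x : ℝ => f (a * x))
      = fun x : ℝ => (Real.sqrt a : ℂ) * f (a * x) := rfl
  rw [← h4, h2, h1, h3, ← mul_assoc, ← ENNReal.ofReal_mul (Real.sqrt_nonneg a),
    mul_inv_cancel₀ (Real.sqrt_pos.2 ha).ne']
  simp

lemma memLp_dil {a : ℝ} (ha : 0 < a) (f : L2R) :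
    MemLp (fun x : ℝ => (Real.sqrt a : ℂ) * f (a * x)) 2 volume := by
  refine ⟨?_, ?_⟩
  · exact ((Lp.aestronglyMeasurable f).comp_quasiMeasurePreserving (qmp_mul ha)).const_mul _
  · rw [eLpNorm_dil ha]
    exact Lp.eLpNorm_lt_top f

/-- The dilation `f ↦ a^{1/2} f(a ·)`, for `a > 0`. -/
def dil {a : ℝ} (ha : 0 < a) : L2R →ₗᵢ[ℂ] L2R where
  toFun f := (memLp_dil ha f).toLp
  map_add' f g := by
    ext1
    filter_upwards [(memLp_dil ha (f + g)).coeFn_toLp, (memLp_dil ha f).coeFn_toLp,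
      (memLp_dil ha g).coeFn_toLp, Lp.coeFn_add (memLp_dil ha f).toLp (memLp_dil ha g).toLp,
      (qmp_mul ha).ae (Lp.coeFn_add f g)] with x h1 h2 h3 h4 h5
    rw [h1, h4, Pi.add_apply, h2, h3, h5, Pi.add_apply, mul_add]
  map_smul' c f := by
    ext1
    filter_upwards [(memLp_dil ha (c • f)).coeFn_toLp, (memLp_dil ha f).coeFn_toLp,
      Lp.coeFn_smul c (memLp_dil ha f).toLp,
      (qmp_mul ha).ae (Lp.coeFn_smul c f)] with x h1 h2 h4 h5
    rw [h1, RingHom.id_apply, h4, Pi.smul_apply, h2, h5, Pi.smul_apply, smul_eq_mul, smul_eq_mul]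
    ring
  norm_map' f := by
    change ‖(memLp_dil ha f).toLp‖ = ‖f‖
    rw [Lp.norm_toLp, eLpNorm_dil ha, Lp.norm_def]

lemma dil_coe {a : ℝ} (ha : 0 < a) (f : L2R) :
    dil ha f =ᵐ[volume] fun x => (Real.sqrt a : ℂ) * f (a * x) :=
  (memLp_dil ha f).coeFn_toLp

lemma dil_surj {a : ℝ} (ha : 0 < a) : Function.Surjective (dil ha) := by
  intro f
  refine ⟨dil (inv_pos.2 ha) f, ?_⟩
  ext1
  filter_upwards [dil_coe ha (dil (inv_pos.2 ha) f),
    (qmp_mul ha).ae (dil_coe (inv_pos.2 ha) f)] with x h1 h2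
  rw [h1, h2, inv_mul_cancel_left₀ ha.ne', ← mul_assoc, ← Complex.ofReal_mul,
    ← Real.sqrt_mul ha.le, mul_inv_cancel₀ ha.ne']
  simp

/-- The dyadic dilation operator `[D f](x) = 2^{1/2} f(2 x)`. -/
def dilOp : L2R ≃ₗᵢ[ℂ] L2R := LinearIsometryEquiv.ofSurjective (dil two_pos) (dil_surj two_pos)

lemma dilOp_coe (f : L2R) : dilOp f =ᵐ[volume] fun x => (Real.sqrt 2 : ℂ) * f (2 * x) :=
  dil_coe two_pos f

/-- The wavelet system `ψ_{k,j} = D^k T^j ψ` with generators `ψ i`, `i : ι`, indexed by the triples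
`(i, k, j)` with `k, j ∈ ℤ`. -/
def waveletSystem {ι : Type*} (ψ : ι → L2R) : ι × ℤ × ℤ → L2R :=
  fun p => (dilOp ^ p.2.1) ((transOp ^ p.2.2) (ψ p.1))

/-! ### The basis `D^m K_{s,j}` of `L²(ℝ)` -/

lemma dilOp_pow_coe (n : ℕ) (f : L2R) :
    (dilOp ^ n : L2R ≃ₗᵢ[ℂ] L2R) f =ᵐ[volume]
      fun x => (Real.sqrt 2 : ℂ) ^ n * f (2 ^ n * x) := by
  induction n with
  | zero => simp
  | succ n ih =>
    have h2 : (dilOp ^ (n + 1) : L2R ≃ₗᵢ[ℂ] L2R) f = dilOp ((dilOp ^ n : L2R ≃ₗᵢ[ℂ] L2R) f) := by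
      rw [pow_succ']; rfl
    rw [h2]
    filter_upwards [dilOp_coe ((dilOp ^ n : L2R ≃ₗᵢ[ℂ] L2R) f),
      (qmp_mul two_pos).ae ih] with x h3 h4
    rw [h3, h4, pow_succ, pow_succ, ← mul_assoc, ← mul_assoc, mul_comm (Real.sqrt 2 : ℂ)]

lemma sqrt_two_ne : (Real.sqrt 2 : ℂ) ≠ 0 := by simp

lemma dilOp_zpow_coe (m : ℤ) (f : L2R) :
    (dilOp ^ m : L2R ≃ₗᵢ[ℂ] L2R) f =ᵐ[volume]
      fun x => (Real.sqrt 2 : ℂ) ^ m * f (2 ^ m * x) := by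
  obtain ⟨n, rfl | rfl⟩ := m.eq_nat_or_neg
  · simpa using dilOp_pow_coe n f
  · set g := (dilOp ^ (-(n : ℤ)) : L2R ≃ₗᵢ[ℂ] L2R) f with hg
    have hf : (dilOp ^ n : L2R ≃ₗᵢ[ℂ] L2R) g = f := by
      rw [hg, zpow_neg, zpow_natCast]
      exact LinearIsometryEquiv.apply_symm_apply _ f
    have h := dilOp_pow_coe n g
    rw [hf] at h
    have hp : (0 : ℝ) < ((2 : ℝ) ^ n)⁻¹ := by positivity
    filter_upwards [(qmp_mul hp).ae h] with x hx
    rw [zpow_neg, zpow_neg, zpow_natCast, zpow_natCast, hx, mul_inv_cancel_left₀ (by positivity),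
      inv_mul_cancel_left₀ (pow_ne_zero _ sqrt_two_ne)]

lemma dilOp_zpow_vanish (m : ℤ) {f : L2R} {s : Set ℝ} (hf : f ∈ L2On s) :
    ∀ᵐ x : ℝ, 2 ^ m * x ∉ s → (dilOp ^ m : L2R ≃ₗᵢ[ℂ] L2R) f x = 0 := by
  have hp : (0 : ℝ) < 2 ^ m := by positivity
  filter_upwards [dilOp_zpow_coe m f, (qmp_mul hp).ae hf] with x h1 h2 h3
  rw [h1, h2 h3, mul_zero]

lemma inner_eq_zero_of_disjoint {f g : L2R} (h : ∀ᵐ x : ℝ, f x = 0 ∨ g x = 0) :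
    inner ℂ f g = 0 := by
  rw [L2.inner_def]
  refine integral_eq_zero_of_ae ?_
  filter_upwards [h] with x hx
  rcases hx with hx | hx <;> simp [hx]

lemma ae_zero_of_orthogonal {s : Set ℝ} (hs : MeasurableSet s) {f : L2R}
    (h : ∀ g ∈ L2On s, inner ℂ g f = 0) : ∀ᵐ x : ℝ, x ∈ s → f x = 0 := by
  have hm : MemLp (s.indicator f) 2 volume := (Lp.memLp f).indicator hs
  have hi := hm.coeFn_toLp
  have h0 := h hm.toLp (by
    change ∀ᵐ x : ℝ, x ∉ s → (hm.toLp (s.indicator f) : L2R) x = 0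
    filter_upwards [hi] with x hx hxs
    rw [hx, indicator_of_notMem hxs])
  have h1 : inner ℂ hm.toLp hm.toLp = 0 := by
    rw [← h0, L2.inner_def, L2.inner_def]
    refine integral_congr_ae ?_
    filter_upwards [hi] with x hx
    by_cases hxs : x ∈ s <;> simp [hx, hxs]
  have h2 := inner_self_eq_zero.1 h1
  have h3 := Lp.coeFn_zero ℂ 2 (volume : Measure ℝ)
  rw [← h2] at h3
  filter_upwards [hi, h3] with x hx hx2 hxs
  rw [hx, indicator_of_mem hxs] at hx2
  simpa using hx2

section KBasis

variable {J : Type*} (Kp : HilbertBasis J ℂ (L2On (Ico 1 2)))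
  (Km : HilbertBasis J ℂ (L2On (Ioc (-2) (-1))))

/-- The functions `K_{s,j}`: `Sum.inl j` stands for `(+, j)` and `Sum.inr j` for `(-, j)`. -/
def baseK : J ⊕ J → L2R := Sum.elim (fun j => (Kp j : L2R)) fun j => (Km j : L2R)

/-- The functions `K_{s,j}^{(m)} = D^m K_{s,j}`. -/
def famK : (J ⊕ J) × ℤ → L2R := fun p => (dilOp ^ p.2) (baseK Kp Km p.1)

lemma orthonormal_baseK : Orthonormal ℂ (baseK Kp Km) := by
  have hd : ∀ i j, inner ℂ (Kp i : L2R) (Km j : L2R) = 0 := by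
    intro i j
    refine inner_eq_zero_of_disjoint ?_
    filter_upwards [(Kp i).2, (Km j).2] with x h1 h2
    by_cases hx : x ∈ Ico (1 : ℝ) 2
    · exact Or.inr (h2 fun h => by linarith [hx.1, h.2])
    · exact Or.inl (h1 hx)
  refine ⟨?_, ?_⟩
  · rintro (j | j)
    · exact Kp.orthonormal.1 j
    · exact Km.orthonormal.1 j
  · rintro (i | i) (j | j) hij
    · exact Kp.orthonormal.2 (fun h => hij (by rw [h]))
    · exact hd i j
    · exact inner_eq_zero_symm.1 (hd j i)
    · exact Km.orthonormal.2 (fun h => hij (by rw [h]))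

lemma baseK_mem (a : J ⊕ J) : baseK Kp Km a ∈ L2On {x | 1 ≤ |x| ∧ |x| < 2} := by
  rcases a with j | j
  · change ∀ᵐ x : ℝ, _ → (Kp j : L2R) x = 0
    filter_upwards [(Kp j).2] with x hx hxs
    refine hx fun h => hxs ?_
    have : |x| = x := abs_of_nonneg (by linarith [h.1])
    exact ⟨by rw [this]; exact h.1, by rw [this]; exact h.2⟩
  · change ∀ᵐ x : ℝ, _ → (Km j : L2R) x = 0
    filter_upwards [(Km j).2] with x hx hxs
    refine hx fun h => hxs ?_
    have : |x| = -x := abs_of_nonpos (by linarith [h.2])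
    exact ⟨by rw [this]; linarith [h.2], by rw [this]; linarith [h.1]⟩

lemma orthonormal_famK : Orthonormal ℂ (famK Kp Km) := by
  have hb := orthonormal_baseK Kp Km
  refine ⟨fun p => ?_, ?_⟩
  · change ‖(dilOp ^ p.2) _‖ = 1
    rw [LinearIsometryEquiv.norm_map]
    exact hb.1 _
  · rintro ⟨a, m⟩ ⟨b, n⟩ hne
    by_cases hmn : m = n
    · subst hmn
      change inner ℂ ((dilOp ^ m) _) ((dilOp ^ m) _) = 0
      rw [LinearIsometryEquiv.inner_map_map]
      exact hb.2 fun h => hne (by simpa using h)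
    · refine inner_eq_zero_of_disjoint ?_
      filter_upwards [dilOp_zpow_vanish m (baseK_mem Kp Km a),
        dilOp_zpow_vanish n (baseK_mem Kp Km b)] with x h1 h2
      by_contra hcon
      rw [not_or] at hcon
      have e1 := not_not.1 (mt h1 hcon.1)
      have e2 := not_not.1 (mt h2 hcon.2)
      have key : ∀ m n : ℤ, (1 ≤ |(2 : ℝ) ^ m * x| ∧ |(2 : ℝ) ^ m * x| < 2) →
          (1 ≤ |(2 : ℝ) ^ n * x| ∧ |(2 : ℝ) ^ n * x| < 2) → ¬ m < n := by
        intro m n h1 h2 hlt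
        have hle : (2 : ℝ) ^ (m + 1) ≤ 2 ^ n := zpow_le_zpow_right₀ (by norm_num) hlt
        rw [zpow_add₀ (by norm_num), zpow_one] at hle
        have hm : (0 : ℝ) < 2 ^ m := by positivity
        have hn : (0 : ℝ) < 2 ^ n := by positivity
        rw [abs_mul, abs_of_pos hm] at h1
        rw [abs_mul, abs_of_pos hn] at h2
        nlinarith [abs_nonneg x, h1.1, h2.2]
      rcases lt_or_gt_of_ne hmn with h | h
      · exact key m n e1 e2 h
      · exact key n m e2 e1 h

lemma ortho_subspace {s : Set ℝ} (b : HilbertBasis J ℂ (L2On s)) {f : L2R}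
    (h : ∀ j, inner ℂ f (b j : L2R) = 0) : ∀ g ∈ L2On s, inner ℂ g f = 0 := by
  intro g hg
  have h1 := b.hasSum_repr ⟨g, hg⟩
  have h2 := (h1.mapL (L2On s).subtypeL).mapL (innerSL ℂ f)
  simp only [Submodule.subtypeL_apply, innerSL_apply_apply, Submodule.coe_smul, inner_smul_right,
    h, mul_zero] at h2
  exact inner_eq_zero_symm.1 (h2.unique hasSum_zero)

lemma famK_complete : (Submodule.span ℂ (range (famK Kp Km)))ᗮ = ⊥ := by
  rw [Submodule.eq_bot_iff]
  intro f hf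
  have hK : ∀ p, inner ℂ (famK Kp Km p) f = 0 := fun p =>
    hf _ (Submodule.subset_span (mem_range_self p))
  have hz : ∀ m : ℤ, ∀ᵐ x : ℝ, (1 ≤ |2 ^ m * x| ∧ |2 ^ m * x| < 2) → f x = 0 := by
    intro m
    set g : L2R := (dilOp ^ (-m)) f with hg
    have hgf : (dilOp ^ m) g = f := by
      rw [hg, zpow_neg]
      exact LinearIsometryEquiv.apply_symm_apply _ f
    have hin : ∀ a, inner ℂ g (baseK Kp Km a) = 0 := by
      intro a
      rw [← LinearIsometryEquiv.inner_map_map (dilOp ^ m), hgf]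
      exact inner_eq_zero_symm.1 (hK (a, m))
    have z1 := ae_zero_of_orthogonal measurableSet_Ico
      (ortho_subspace Kp (f := g) fun j => hin (Sum.inl j))
    have z2 := ae_zero_of_orthogonal measurableSet_Ioc
      (ortho_subspace Km (f := g) fun j => hin (Sum.inr j))
    have hp : (0 : ℝ) < 2 ^ m := by positivity
    have hc := dilOp_zpow_coe m g
    rw [hgf] at hc
    filter_upwards [hc, (qmp_mul hp).ae z1, (qmp_mul hp).ae z2] with x h0 h1 h2 hx
    rw [h0]
    rcases abs_cases ((2 : ℝ) ^ m * x) with ⟨h, _⟩ | ⟨h, _⟩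
    · rw [h1 ⟨by linarith [hx.1], by linarith [hx.2]⟩, mul_zero]
    · rw [h2 ⟨by linarith [hx.2], by linarith [hx.1]⟩, mul_zero]
  ext1
  have h0 : ∀ᵐ x : ℝ, x ≠ 0 := by simp [ae_iff]
  filter_upwards [ae_all_iff.2 hz, h0, Lp.coeFn_zero ℂ 2 (volume : Measure ℝ)] with x hx hx0 hz
  rw [hz, Pi.zero_apply]
  obtain ⟨n, hn⟩ := exists_mem_Ico_zpow (abs_pos.2 hx0) (one_lt_two : (1 : ℝ) < 2)
  refine hx (-n) ?_
  have hp : (0 : ℝ) < 2 ^ n := by positivity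
  rw [abs_mul, zpow_neg, abs_of_pos (inv_pos.2 hp)]
  rw [mem_Ico, zpow_add₀ (by norm_num), zpow_one] at hn
  rw [inv_mul_eq_div, le_div_iff₀ hp, div_lt_iff₀ hp]
  exact ⟨by linarith [hn.1], by linarith [hn.2]⟩

/-- The orthonormal basis `K_{s,j}^{(m)}` of `L²(ℝ)`. -/
def basisK : HilbertBasis ((J ⊕ J) × ℤ) ℂ L2R :=
  HilbertBasis.mkOfOrthogonalEqBot (orthonormal_famK Kp Km) (famK_complete Kp Km)

end KBasis

/-! ### The space `L²(∂𝔻; H)` -/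

instance : MeasurableSpace Circle := borel Circle
instance : BorelSpace Circle := ⟨rfl⟩

/-- Normalized Lebesgue measure on the unit circle: the image of normalized Lebesgue measure on
`ℝ/ℤ` under `θ ↦ e^{2πiθ}`. -/
def circleMeasure : Measure Circle :=
  (AddCircle.haarAddCircle (T := 1)).map AddCircle.toCircle

lemma mp_toCircle : MeasurePreserving (AddCircle.toCircle (T := 1)) AddCircle.haarAddCircle
    circleMeasure := ⟨AddCircle.continuous_toCircle.measurable, rfl⟩

instance : IsProbabilityMeasure circleMeasure :=
  Measure.isProbabilityMeasure_map AddCircle.continuous_toCircle.measurable.aemeasurable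

section CircleSpace

variable {H : Type*} [NormedAddCommGroup H] [InnerProductSpace ℂ H]

variable (H) in
/-- The Hilbert space `L²(∂𝔻; H)`. -/
abbrev L2Circle : Type _ := Lp H 2 circleMeasure

lemma continuous_zpow_circle (m : ℤ) : Continuous fun ω : Circle => ((ω ^ m : Circle) : ℂ) :=
  (show Continuous fun ω : Circle => (ω : ℂ) by fun_prop).comp (continuous_zpow m)

lemma memLp_monomial (h : H) (m : ℤ) :
    MemLp (fun ω : Circle => ((ω ^ m : Circle) : ℂ) • h) 2 circleMeasure := by
  refine MemLp.of_bound ((continuous_zpow_circle m).smul continuous_const).aestronglyMeasurable ‖h‖ ?_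
  filter_upwards with ω
  rw [norm_smul, Circle.norm_coe, one_mul]

/-- The function `ω ↦ ω^m h`. -/
def monomial (h : H) (m : ℤ) : L2Circle H := (memLp_monomial h m).toLp

lemma monomial_coe (h : H) (m : ℤ) :
    monomial h m =ᵐ[circleMeasure] fun ω => ((ω ^ m : Circle) : ℂ) • h :=
  (memLp_monomial h m).coeFn_toLp

lemma integral_circle_mul (g : Circle → ℂ) (hg : AEStronglyMeasurable g circleMeasure) (m : ℤ) :
    ∫ ω, ((ω ^ m : Circle) : ℂ) * g ω ∂circleMeasure
      = fourierCoeff (fun t : AddCircle (1 : ℝ) => g (AddCircle.toCircle t)) (-m) := by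
  rw [circleMeasure, integral_map AddCircle.continuous_toCircle.measurable.aemeasurable]
  · simp only [fourierCoeff, neg_neg, fourier_apply, AddCircle.toCircle_zsmul, smul_eq_mul]
  · exact (continuous_zpow_circle m).aestronglyMeasurable.mul hg

lemma integral_circle_zpow (m : ℤ) :
    ∫ ω, ((ω ^ m : Circle) : ℂ) ∂circleMeasure = if m = 0 then 1 else 0 := by
  have h := integral_circle_mul (fun _ => 1) aestronglyMeasurable_const m
  simp only [mul_one] at h
  rw [h]
  have h1 : (fun _ : AddCircle (1 : ℝ) => (1 : ℂ)) = ⇑(fourier (T := 1) 0) := by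
    ext; simp
  have h2 := congrFun (fourierCoeff_fourier (T := 1) 0) (-m)
  rw [h1, h2]
  by_cases hm : m = 0 <;> simp [hm]

lemma inner_monomial (g h : H) (m n : ℤ) :
    inner ℂ (monomial g m) (monomial h n) = (if m = n then 1 else 0) * inner ℂ g h := by
  rw [L2.inner_def]
  have : ∫ ω, inner ℂ (monomial g m ω) (monomial h n ω) ∂circleMeasure
      = ∫ ω, ((ω ^ (n - m) : Circle) : ℂ) * inner ℂ g h ∂circleMeasure := by
    refine integral_congr_ae ?_
    filter_upwards [monomial_coe g m, monomial_coe h n] with ω h1 h2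
    rw [h1, h2, inner_smul_left, inner_smul_right, ← mul_assoc, ← Circle.coe_inv_eq_conj,
      ← Circle.coe_mul, ← zpow_neg, ← zpow_add]
    rw [show -m + n = n - m by ring]
  rw [this, integral_mul_const, integral_circle_zpow]
  congr 2
  simp [sub_eq_zero, eq_comm]

lemma inner_monomial_left (h : H) (m : ℤ) (f : L2Circle H) :
    inner ℂ (monomial h m) f = ∫ ω, ((ω ^ (-m) : Circle) : ℂ) * inner ℂ h (f ω) ∂circleMeasure := by
  rw [L2.inner_def]
  refine integral_congr_ae ?_
  filter_upwards [monomial_coe h m] with ω h1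
  rw [h1, inner_smul_left, ← Circle.coe_inv_eq_conj, ← zpow_neg]

lemma ae_zero_of_coeff (g : Circle → ℂ) (hg : MemLp g 2 circleMeasure)
    (h : ∀ m : ℤ, ∫ ω, ((ω ^ (-m) : Circle) : ℂ) * g ω ∂circleMeasure = 0) :
    ∀ᵐ ω ∂circleMeasure, g ω = 0 := by
  have hG : MemLp (fun t : AddCircle (1 : ℝ) => g (AddCircle.toCircle t)) 2
      AddCircle.haarAddCircle := hg.comp_measurePreserving mp_toCircle
  have h0 : hG.toLp = 0 := by
    apply fourierBasis.repr.injective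
    ext m
    rw [fourierBasis_repr, fourierCoeff_congr_ae hG.coeFn_toLp]
    have := integral_circle_mul g hg.1 (-m)
    rw [h m, neg_neg] at this
    rw [← this]
    simp
  have h1 := hG.coeFn_toLp
  rw [h0] at h1
  have h2 : ∀ᵐ t ∂AddCircle.haarAddCircle (T := 1), g (AddCircle.toCircle t) = 0 := by
    filter_upwards [h1, Lp.coeFn_zero ℂ 2 (AddCircle.haarAddCircle (T := 1))] with t h3 h4
    rw [← h3, h4, Pi.zero_apply]
  have h5 : ∀ᵐ ω ∂circleMeasure, hg.1.mk g ω = 0 := by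
    refine (ae_map_iff AddCircle.continuous_toCircle.measurable.aemeasurable
      (measurableSet_eq_fun hg.1.stronglyMeasurable_mk.measurable measurable_const)).2 ?_
    filter_upwards [h2, mp_toCircle.quasiMeasurePreserving.ae hg.1.ae_eq_mk] with t h3 h4
    rw [← h4, h3]
  filter_upwards [h5, hg.1.ae_eq_mk] with ω h6 h7
  rw [h7, h6]

variable {A : Type*} (u : HilbertBasis A ℂ H)

lemma orthonormal_monomial :
    Orthonormal ℂ (fun p : A × ℤ => monomial (u p.1) p.2) := by
  classical
  rw [orthonormal_iff_ite]
  rintro ⟨a, m⟩ ⟨b, n⟩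
  rw [inner_monomial, orthonormal_iff_ite.1 u.orthonormal]
  by_cases h1 : a = b <;> by_cases h2 : m = n <;> simp [h1, h2]

lemma monomial_complete [Countable A] :
    (Submodule.span ℂ (range fun p : A × ℤ => monomial (u p.1) p.2))ᗮ = ⊥ := by
  rw [Submodule.eq_bot_iff]
  intro f hf
  have hK : ∀ a m, inner ℂ (monomial (u a) m) f = 0 := fun a m =>
    hf _ (Submodule.subset_span (mem_range_self (a, m)))
  have hz : ∀ a, ∀ᵐ ω ∂circleMeasure, inner ℂ (u a) (f ω) = 0 := fun a => by
    refine ae_zero_of_coeff _ ((Lp.memLp f).const_inner (u a)) fun m => ?_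
    rw [← inner_monomial_left, hK]
  ext1
  filter_upwards [ae_all_iff.2 hz, Lp.coeFn_zero H 2 circleMeasure] with ω h1 h2
  rw [h2, Pi.zero_apply]
  apply u.repr.injective
  ext a
  rw [u.repr_apply_apply, h1 a]
  simp

/-- The orthonormal basis `ω ↦ ω^m u_a` of `L²(∂𝔻; H)`, where `(u_a)` is one of `H`. -/
def basisCircle [CompleteSpace H] [Countable A] : HilbertBasis (A × ℤ) ℂ (L2Circle H) :=
  HilbertBasis.mkOfOrthogonalEqBot (orthonormal_monomial u) (monomial_complete u)

/-- `s` is a field of fibers of the bounded operator `R` on `L²(∂𝔻; H)`, written `R = s(ω)`: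
for each `v`, `s(ω) v(ω) = (R v)(ω)` for a.e. `ω`. -/
def HasFibers (R : L2Circle H →L[ℂ] L2Circle H) (s : Circle → H →L[ℂ] H) : Prop :=
  ∀ v : L2Circle H, ∀ᵐ ω ∂circleMeasure, s ω (v ω) = (R v) ω

/-- Decomposable operators on `L²(∂𝔻; H)`. -/
def IsDecomposable (R : L2Circle H →L[ℂ] L2Circle H) : Prop := ∃ s, HasFibers R s

/-- `ess sup_ω sup_{‖v‖ = 1} ‖s(ω) v‖`, in `[0, ∞]`. -/
def essSupFiber (s : Circle → H →L[ℂ] H) : ℝ≥0∞ :=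
  essSup (fun ω => ⨆ (v : H) (_ : ‖v‖ = 1), ‖s ω v‖ₑ) circleMeasure

/-- `ess inf_ω inf_{‖v‖ = 1} ‖s(ω) v‖`, in `[0, ∞]`. -/
def essInfFiber (s : Circle → H →L[ℂ] H) : ℝ≥0∞ :=
  essInf (fun ω => ⨅ (v : H) (_ : ‖v‖ = 1), ‖s ω v‖ₑ) circleMeasure

end CircleSpace

/-! ### The dilation representation -/

section DilationRep

/-- `ℓ²(J) ⊕ ℓ²(J)`, the orthogonal sum. -/
abbrev FiberSpace (J : Type*) : Type _ :=
  WithLp 2 (lp (fun _ : J => ℂ) 2 × lp (fun _ : J => ℂ) 2)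

variable {J : Type*} [Countable J] (Kp : HilbertBasis J ℂ (L2On (Ico 1 2)))
  (Km : HilbertBasis J ℂ (L2On (Ioc (-2) (-1)))) (u : HilbertBasis (J ⊕ J) ℂ (FiberSpace J))

/-- The unitary operator `𝒢 : L²(ℝ) → L²(∂𝔻; ℓ²(J) ⊕ ℓ²(J))`,
`f ↦ ⊕_{s,j} [∑_m ω^m ⟨f, K_{s,j}^{(m)}⟩] u_{s,j}`. -/
def dilationTransform : L2R ≃ₗᵢ[ℂ] L2Circle (FiberSpace J) :=
  (basisK Kp Km).repr.trans (basisCircle u).repr.symm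

lemma hasSum_dilationTransform (f : L2R) :
    HasSum (fun p : (J ⊕ J) × ℤ =>
      inner ℂ ((dilOp ^ p.2) (baseK Kp Km p.1)) f • monomial (u p.1) p.2)
      (dilationTransform Kp Km u f) := by
  have h := (basisCircle u).hasSum_repr_symm ((basisK Kp Km).repr f)
  simp only [HilbertBasis.repr_apply_apply] at h
  rw [show ⇑(basisK Kp Km) = famK Kp Km from HilbertBasis.coe_mkOfOrthogonalEqBot _ _,
    show ⇑(basisCircle u) = fun p : (J ⊕ J) × ℤ => monomial (u p.1) p.2 from
      HilbertBasis.coe_mkOfOrthogonalEqBot _ _] at h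
  exact h

/-- The operator `𝒢 S 𝒢⁻¹` on `L²(∂𝔻; ℓ²(J) ⊕ ℓ²(J))`. -/
def dilationRep (S : L2R →L[ℂ] L2R) :
    L2Circle (FiberSpace J) →L[ℂ] L2Circle (FiberSpace J) :=
  ((dilationTransform Kp Km u).toContinuousLinearEquiv : L2R →L[ℂ] L2Circle (FiberSpace J)) ∘L S ∘L
    ((dilationTransform Kp Km u).symm.toContinuousLinearEquiv :
      L2Circle (FiberSpace J) →L[ℂ] L2R)

end DilationRep

end WaveletFrame

end

open WaveletFrame

/-! Pairing the frame series with `f` gives `⟨S f, f⟩ = ∑ |⟨f, xᵢ⟩|²`, so frame bounds are bounds on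
the quadratic form of the positive operator `S`. Conversely, a Bessel bound controls synthesis
(`IsUpperBound.norm_sum_sq_le`), which makes the series unconditionally summable. A lower bound is
coercivity, hence invertibility (`isFrame_iff`); for positive `S` it amounts to `‖S f‖ ≥ c ‖f‖`
(`isFrame_iff_bddBelow`).

`D` permutes the wavelet system, so `S` commutes with `D`, and `𝒢` turns `D` into multiplication by
`ω`. An operator `R` commuting with the powers of `ω` is decomposable (`isDecomposable_of_comm`): it
is local, `R (1_E h) = 1_E R h`. Testing norms on all sets `E` then bounds `(R h)(ω)` by `‖R‖ ‖h‖`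
for a.e. `ω`, and separability makes the null set independent of `h`. Hence `u_a ↦ (R u_a)(ω)`
extends to a bounded operator on `H`.

The same localization, with integration as its converse, shows that `S` and almost all of its fibers
satisfy the same inequalities `‖S f‖ ≤ c ‖f‖` and `c ‖f‖ ≤ ‖S f‖`. This yields `‖S‖ = α`, `‖S⁻¹‖ =
β⁻¹` and the fiber criterion for frames. -/

noncomputable section

namespace WaveletFrame

/-! ### Frames and frame operators in a Hilbert space -/

section AbstractFrames

lemma ofReal_mul_enorm_sq {E : Type*} [NormedAddCommGroup E] {A : ℝ} (hA : 0 ≤ A) (f : E) :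
    ENNReal.ofReal A * ‖f‖ₑ ^ 2 = ENNReal.ofReal (A * ‖f‖ ^ 2) := by
  rw [ENNReal.ofReal_mul hA, ENNReal.ofReal_pow (norm_nonneg _), ofReal_norm]

variable {H : Type*} [NormedAddCommGroup H] [InnerProductSpace ℂ H] {I : Type*} {x : I → H}
  {S : H →L[ℂ] H}

lemma IsFrameOperator.hasSum_norm_sq (hS : IsFrameOperator x S) (f : H) :
    HasSum (fun i => ‖inner ℂ (x i) f‖ ^ 2) (RCLike.re (inner ℂ (S f) f)) := by
  have h := (hS f).mapL (innerSL ℂ f)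
  have h2 := Complex.hasSum_re h
  rw [innerSL_apply_apply, ← RCLike.re_eq_complex_re, ← inner_re_symm] at h2
  convert h2 using 2 with i
  rw [innerSL_apply_apply, inner_smul_right, ← inner_conj_symm f (x i), RCLike.mul_conj]
  norm_cast

lemma IsFrameOperator.tsum_enorm_sq (hS : IsFrameOperator x S) (f : H) :
    ∑' i, ‖inner ℂ (x i) f‖ₑ ^ 2 = ENNReal.ofReal (RCLike.re (inner ℂ (S f) f)) := by
  rw [← (hS.hasSum_norm_sq f).tsum_eq,
    ENNReal.ofReal_tsum_of_nonneg (fun _ => by positivity) (hS.hasSum_norm_sq f).summable]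
  congr 1 with i
  rw [ENNReal.ofReal_pow (norm_nonneg _), ofReal_norm]

/-- Both sides are the sum of the same series of nonnegative reals. Over `ℂ`, a real nonnegative
quadratic form already implies self-adjointness, so positivity follows. -/
lemma IsFrameOperator.inner_eq (hS : IsFrameOperator x S) (f : H) :
    ((RCLike.re (inner ℂ (S f) f) : ℝ) : ℂ) = inner ℂ (S f) f := by
  have h := (hS f).mapL (innerSL ℂ f)
  have h2 : HasSum (fun i => ((‖inner ℂ (x i) f‖ ^ 2 : ℝ) : ℂ))
      ((RCLike.re (inner ℂ (S f) f) : ℝ) : ℂ) :=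
    Complex.hasSum_ofReal.2 (hS.hasSum_norm_sq f)
  have h3 : ((RCLike.re (inner ℂ (S f) f) : ℝ) : ℂ) = inner ℂ f (S f) := by
    refine h2.unique ?_
    rw [innerSL_apply_apply] at h
    have h4 : ∀ i, innerSL ℂ f (inner ℂ (x i) f • x i) = ((‖inner ℂ (x i) f‖ ^ 2 : ℝ) : ℂ) := by
      intro i
      rw [innerSL_apply_apply, inner_smul_right, ← inner_conj_symm f (x i), RCLike.mul_conj]
      norm_cast
    simpa only [h4] using h
  rw [← inner_conj_symm, ← h3]
  simp

lemma IsFrameOperator.isPositive (hS : IsFrameOperator x S) : S.IsPositive := by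
  rw [ContinuousLinearMap.isPositive_iff_complex]
  exact fun f => ⟨hS.inner_eq f, (hS.hasSum_norm_sq f).nonneg fun _ => by positivity⟩

lemma IsFrameOperator.isLowerBound_iff (hS : IsFrameOperator x S) {A : ℝ} :
    IsLowerBound x A ↔ 0 < A ∧ ∀ f : H, A * ‖f‖ ^ 2 ≤ RCLike.re (inner ℂ (S f) f) := by
  refine and_congr_right fun hA => forall_congr' fun f => ?_
  rw [hS.tsum_enorm_sq, ofReal_mul_enorm_sq hA.le,
    ENNReal.ofReal_le_ofReal_iff (hS.isPositive.re_inner_nonneg_left f)]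

lemma IsFrameOperator.isUpperBound_iff (hS : IsFrameOperator x S) {A : ℝ} :
    IsUpperBound x A ↔ 0 < A ∧ ∀ f : H, RCLike.re (inner ℂ (S f) f) ≤ A * ‖f‖ ^ 2 := by
  refine and_congr_right fun hA => forall_congr' fun f => ?_
  rw [hS.tsum_enorm_sq, ofReal_mul_enorm_sq hA.le, ENNReal.ofReal_le_ofReal_iff (by positivity)]

lemma re_inner_apply_self_le (S : H →L[ℂ] H) (f : H) :
    RCLike.re (inner ℂ (S f) f) ≤ ‖S‖ * ‖f‖ ^ 2 := by
  refine (re_inner_le_norm _ _).trans ?_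
  rw [pow_two, ← mul_assoc]
  gcongr
  exact S.le_opNorm f

lemma IsFrameOperator.isBessel (hS : IsFrameOperator x S) : IsBessel x := by
  refine ⟨‖S‖ + 1, hS.isUpperBound_iff.2 ⟨by positivity, fun f => ?_⟩⟩
  refine (re_inner_apply_self_le S f).trans ?_
  gcongr
  linarith

lemma IsUpperBound.summable {B : ℝ} (h : IsUpperBound x B) (f : H) :
    Summable (fun i => ‖inner ℂ (x i) f‖ ^ 2) := by
  have h1 : ∑' i, ENNReal.ofReal (‖inner ℂ (x i) f‖ ^ 2) ≠ ∞ := by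
    refine ne_top_of_le_ne_top ?_ ((le_of_eq ?_).trans (h.2 f))
    · exact ENNReal.mul_ne_top ENNReal.ofReal_ne_top (by simp)
    · congr 1 with i
      rw [ENNReal.ofReal_pow (norm_nonneg _), ofReal_norm]
  have h2 := ENNReal.summable_toReal h1
  refine h2.congr fun i => ?_
  rw [ENNReal.toReal_ofReal (by positivity)]

lemma IsUpperBound.sum_le {B : ℝ} (h : IsUpperBound x B) (f : H) (T : Finset I) :
    ∑ i ∈ T, ‖inner ℂ (x i) f‖ ^ 2 ≤ B * ‖f‖ ^ 2 := by
  have hB := h.1.le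
  have h1 := (ENNReal.sum_le_tsum T).trans (h.2 f)
  rw [ofReal_mul_enorm_sq h.1.le] at h1
  rw [← ENNReal.ofReal_le_ofReal_iff (by positivity)]
  refine le_trans (le_of_eq ?_) h1
  rw [ENNReal.ofReal_sum_of_nonneg fun _ _ => by positivity]
  congr 1 with i
  rw [ENNReal.ofReal_pow (norm_nonneg _), ofReal_norm]

/-- Duality: for `y = ∑ cᵢ xᵢ`, expand `⟨y, y⟩`, apply Cauchy–Schwarz and the Bessel bound at `y`
itself, then cancel `‖y‖²`. -/
lemma IsUpperBound.norm_sum_sq_le {B : ℝ} (h : IsUpperBound x B) (c : I → ℂ) (T : Finset I) :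
    ‖∑ i ∈ T, c i • x i‖ ^ 2 ≤ B * ∑ i ∈ T, ‖c i‖ ^ 2 := by
  set y := ∑ i ∈ T, c i • x i with hy
  have h1 : ‖y‖ ^ 2 ≤ ∑ i ∈ T, ‖c i‖ * ‖inner ℂ (x i) y‖ := by
    have h2 : inner ℂ y y = ∑ i ∈ T, (starRingEnd ℂ) (c i) * inner ℂ (x i) y := by
      conv_lhs => rw [hy, sum_inner]
      simp only [inner_smul_left, hy]
    have h3 : ‖y‖ ^ 2 = ‖(inner ℂ y y : ℂ)‖ := by
      rw [inner_self_eq_norm_sq_to_K (𝕜 := ℂ)]; simp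
    rw [h3, h2]
    refine (norm_sum_le _ _).trans (Finset.sum_le_sum fun i _ => ?_)
    rw [norm_mul, RCLike.norm_conj]
  have h4 := Finset.sum_mul_sq_le_sq_mul_sq T (fun i => ‖c i‖) fun i => ‖inner ℂ (x i) y‖
  have h5 := h.sum_le y T
  have h6 : (‖y‖ ^ 2) ^ 2 ≤ (B * ∑ i ∈ T, ‖c i‖ ^ 2) * ‖y‖ ^ 2 := by
    calc (‖y‖ ^ 2) ^ 2 ≤ (∑ i ∈ T, ‖c i‖ * ‖inner ℂ (x i) y‖) ^ 2 := by gcongr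
      _ ≤ _ := h4
      _ ≤ (∑ i ∈ T, ‖c i‖ ^ 2) * (B * ‖y‖ ^ 2) := by gcongr
      _ = _ := by ring
  rcases (sq_nonneg ‖y‖).eq_or_lt with h0 | h0
  · rw [← h0]
    have := h.1.le
    positivity
  · nlinarith

lemma IsUpperBound.summable_smul [CompleteSpace H] {B : ℝ} (h : IsUpperBound x B) (f : H) :
    Summable (fun i => inner ℂ (x i) f • x i) := by
  rw [summable_iff_vanishing_norm]
  intro ε hε
  have hB := h.1
  -- The synthesis bound multiplies the tail of squared coefficients by `B`; the threshold `ε² / B`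
  -- thus yields `ε²`.
  obtain ⟨s, hs⟩ := summable_iff_vanishing_norm.1 (h.summable f) (ε ^ 2 / B) (by positivity)
  refine ⟨s, fun t ht => ?_⟩
  have h1 := hs t ht
  rw [Real.norm_of_nonneg (by positivity), lt_div_iff₀ hB] at h1
  have h2 := h.norm_sum_sq_le (fun i => inner ℂ (x i) f) t
  refine lt_of_pow_lt_pow_left₀ 2 hε.le ?_
  linarith

/-- The frame operator of a Bessel system. -/
def IsUpperBound.frameOperator [CompleteSpace H] {B : ℝ} (h : IsUpperBound x B) : H →L[ℂ] H :=
  LinearMap.mkContinuous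
    { toFun := fun f => ∑' i, inner ℂ (x i) f • x i
      map_add' := fun f g => by
        rw [← (h.summable_smul f).tsum_add (h.summable_smul g)]
        simp only [inner_add_right, add_smul]
      map_smul' := fun c f => by
        rw [RingHom.id_apply, ← (h.summable_smul f).tsum_const_smul]
        simp only [inner_smul_right, mul_smul] } B fun f => by
    have hB := h.1.le
    have h1 := (h.summable_smul f).hasSum.norm.pow 2
    have h2 : ‖∑' i, inner ℂ (x i) f • x i‖ ^ 2 ≤ (B * ‖f‖) ^ 2 := by
      refine le_of_tendsto h1 (Filter.Eventually.of_forall fun T => ?_)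
      refine (h.norm_sum_sq_le _ T).trans ?_
      rw [mul_pow, pow_two B, mul_assoc]
      gcongr
      exact h.sum_le f T
    exact le_of_sq_le_sq h2 (by positivity)

lemma IsUpperBound.isFrameOperator [CompleteSpace H] {B : ℝ} (h : IsUpperBound x B) :
    IsFrameOperator x h.frameOperator := fun f => (h.summable_smul f).hasSum

lemma isBessel_iff [CompleteSpace H] : IsBessel x ↔ ∃ S, IsFrameOperator x S :=
  ⟨fun ⟨_, h⟩ => ⟨_, h.isFrameOperator⟩, fun ⟨_, h⟩ => h.isBessel⟩

/-- A unitary that permutes the family only reindexes the series, which is harmless under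
unconditional convergence. -/
lemma IsFrameOperator.comm (hS : IsFrameOperator x S) (U : H ≃ₗᵢ[ℂ] H) (e : I ≃ I)
    (hU : ∀ i, U (x i) = x (e i)) (f : H) : S (U f) = U (S f) := by
  refine ((e.hasSum_iff).2 (hS (U f))).unique ?_
  have h : ∀ i, inner ℂ (x (e i)) (U f) • x (e i) = U (inner ℂ (x i) f • x i) := fun i => by
    rw [← hU, LinearIsometryEquiv.inner_map_map, map_smul]
  simp only [Function.comp_def, h]
  exact (hS f).mapL (U.toContinuousLinearEquiv : H →L[ℂ] H)

/-- A positive operator satisfies `‖S f‖² ≤ (‖S‖ + 1) ⟨S f, f⟩`. -/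
lemma norm_apply_sq_le_of_isPositive (hS : S.IsPositive) (f : H) :
    ‖S f‖ ^ 2 ≤ (‖S‖ + 1) * RCLike.re (inner ℂ (S f) f) := by
  -- Positivity is tested at `f - t S f`. The value of `t` makes the quadratic term at most `t ‖S
  -- f‖²`, half of what the cross terms subtract; the `+ 1` covers `S = 0`.
  set t : ℝ := (‖S‖ + 1)⁻¹ with ht
  have hM : 0 < ‖S‖ + 1 := by positivity
  have h0 := hS.re_inner_nonneg_left (f - (t : ℂ) • S f)
  have h1 : RCLike.re (inner ℂ (S (f - (t : ℂ) • S f)) (f - (t : ℂ) • S f))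
      = RCLike.re (inner ℂ (S f) f) - 2 * t * ‖S f‖ ^ 2
        + t ^ 2 * RCLike.re (inner ℂ (S (S f)) (S f)) := by
    have h2 : inner ℂ (S (S f)) f = inner ℂ (S f) (S f) := hS.inner_left_eq_inner_right _ _
    simp only [map_sub, map_smul, inner_sub_left, inner_sub_right, inner_smul_left,
      inner_smul_right, h2, Complex.conj_ofReal, RCLike.re_eq_complex_re, Complex.re_ofReal_mul,
      Complex.sub_re]
    have h3 : (inner ℂ (S f) (S f) : ℂ).re = ‖S f‖ ^ 2 := by
      rw [inner_self_eq_norm_sq_to_K]; norm_cast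
    rw [h3]
    ring
  have h4 := re_inner_apply_self_le S (S f)
  have h5 : t * (‖S‖ + 1) = 1 := inv_mul_cancel₀ hM.ne'
  have h6 : t ^ 2 * RCLike.re (inner ℂ (S (S f)) (S f)) ≤ t * ‖S f‖ ^ 2 := by
    calc t ^ 2 * RCLike.re (inner ℂ (S (S f)) (S f)) ≤ t ^ 2 * ((‖S‖ + 1) * ‖S f‖ ^ 2) := by
          gcongr; nlinarith [sq_nonneg ‖S f‖]
      _ = (t * (‖S‖ + 1)) * t * ‖S f‖ ^ 2 := by ring
      _ = _ := by rw [h5]; ring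
  have h7 : t * ‖S f‖ ^ 2 ≤ RCLike.re (inner ℂ (S f) f) := by linarith
  calc ‖S f‖ ^ 2 = (‖S‖ + 1) * (t * ‖S f‖ ^ 2) := by rw [← mul_assoc, mul_comm _ t, h5, one_mul]
    _ ≤ _ := by gcongr

/-- Cauchy–Schwarz turns a form bound `A` into a norm bound `A`. In the other direction
`norm_apply_sq_le_of_isPositive` turns `c` into `c² / (‖S‖ + 1)`, with no square root of `S`. -/
lemma IsFrameOperator.isFrame_iff_bddBelow (hS : IsFrameOperator x S) :
    IsFrame x ↔ ∃ c : NNReal, 0 < c ∧ ∀ f, c * ‖f‖ₑ ≤ ‖S f‖ₑ := by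
  have key : ∀ (c : NNReal) f, (c * ‖f‖ₑ ≤ ‖S f‖ₑ ↔ c * ‖f‖ ≤ ‖S f‖) := fun c f => by
    rw [enorm_eq_nnnorm, enorm_eq_nnnorm, ← ENNReal.coe_mul, ENNReal.coe_le_coe,
      ← NNReal.coe_le_coe]
    simp
  simp only [key]
  constructor
  · rintro ⟨⟨A, hA⟩, -⟩
    obtain ⟨h0, h⟩ := hS.isLowerBound_iff.1 hA
    refine ⟨NNReal.mk A h0.le, h0, fun f => ?_⟩
    rcases (norm_nonneg f).eq_or_lt with hf | hf
    · rw [← hf]; simp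
    · have h2 := (h f).trans (re_inner_le_norm _ _)
      refine le_of_mul_le_mul_right ?_ hf
      rw [NNReal.coe_mk, mul_assoc, ← pow_two]
      exact h2
  · rintro ⟨c, hc, h⟩
    refine ⟨⟨c ^ 2 / (‖S‖ + 1), hS.isLowerBound_iff.2 ⟨by positivity, fun f => ?_⟩⟩, hS.isBessel⟩
    rw [div_mul_eq_mul_div, div_le_iff₀ (by positivity), ← mul_pow, mul_comm _ (‖S‖ + 1)]
    refine le_trans ?_ (norm_apply_sq_le_of_isPositive hS.isPositive f)
    gcongr
    exact h f

lemma IsFrameOperator.isFrame_of_inverse (hS : IsFrameOperator x S) {R : H →L[ℂ] H}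
    (hR : R ∘L S = ContinuousLinearMap.id ℂ H) : IsFrame x := by
  rw [hS.isFrame_iff_bddBelow]
  refine ⟨(‖R‖₊ + 1)⁻¹, by positivity, fun f => ?_⟩
  have h1 : ‖f‖₊ ≤ (‖R‖₊ + 1) * ‖S f‖₊ := by
    have h2 : R (S f) = f := DFunLike.congr_fun hR f
    calc ‖f‖₊ = ‖R (S f)‖₊ := by rw [h2]
      _ ≤ ‖R‖₊ * ‖S f‖₊ := R.le_opNNNorm _
      _ ≤ _ := by gcongr; simp
  rw [enorm_eq_nnnorm, enorm_eq_nnnorm, ← ENNReal.coe_mul, ENNReal.coe_le_coe]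
  rwa [inv_mul_le_iff₀ (by positivity)]

lemma isFrame_iff [CompleteSpace H] :
    IsFrame x ↔ ∃ S R : H →L[ℂ] H, IsFrameOperator x S ∧
      S ∘L R = ContinuousLinearMap.id ℂ H ∧ R ∘L S = ContinuousLinearMap.id ℂ H := by
  constructor
  · rintro ⟨⟨A, hA⟩, B, hB⟩
    have hS := hB.isFrameOperator
    obtain ⟨h0, h⟩ := hS.isLowerBound_iff.1 hA
    have hu : IsUnit hB.frameOperator := by
      -- Lax–Milgram: the lower frame bound is coercivity of the form of `S`.
      refine ContinuousLinearMap.isUnit_of_forall_le_norm_inner_map _ (c := NNReal.mk A h0.le) h0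
        fun f => ?_
      rw [NNReal.coe_mk, mul_comm]
      exact (h f).trans (RCLike.re_le_norm _)
    obtain ⟨v, hv⟩ := hu
    refine ⟨_, (v⁻¹ : (H →L[ℂ] H)ˣ), hS, ?_, ?_⟩
    · rw [← hv]; exact v.mul_inv
    · rw [← hv]; exact v.inv_mul
  · rintro ⟨S, R, hS, -, hR⟩
    exact hS.isFrame_of_inverse hR

/-- Equal bounds fix the form as `B ‖f‖²`, and complex polarization recovers the operator. A nonzero
vector is needed for sharpness: on the zero space every positive number is both a lower and an upper
bound. -/
lemma isTightFrame_iff [CompleteSpace H] [Nontrivial H] {B : ℝ} (hB : 0 < B) :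
    IsTightFrame x B ↔ IsFrameOperator x ((B : ℂ) • ContinuousLinearMap.id ℂ H) := by
  have hin : ∀ f : H, RCLike.re (inner ℂ (((B : ℂ) • ContinuousLinearMap.id ℂ H) f) f)
      = B * ‖f‖ ^ 2 := fun f => by
    simp only [smul_apply, ContinuousLinearMap.id_apply, inner_smul_left,
      Complex.conj_ofReal, RCLike.re_eq_complex_re, Complex.re_ofReal_mul]
    rw [inner_self_eq_norm_sq_to_K]; norm_cast
  constructor
  · rintro ⟨-, ⟨h1, -⟩, h2, -⟩
    have hS := (show IsUpperBound x B from h2).isFrameOperator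
    have h1 := (hS.isLowerBound_iff.1 h1).2
    have h2' := (hS.isUpperBound_iff.1 h2).2
    convert hS using 1
    have : (((B : ℂ) • ContinuousLinearMap.id ℂ H : H →L[ℂ] H) : H →ₗ[ℂ] H)
        = (IsUpperBound.frameOperator h2 : H →L[ℂ] H) := by
      rw [← ext_inner_map]
      intro f
      have h3 := hS.inner_eq f
      rw [le_antisymm (h2' f) (h1 f)] at h3
      refine Eq.trans ?_ h3
      rw [ContinuousLinearMap.coe_coe, smul_apply,
        ContinuousLinearMap.id_apply, inner_smul_left, inner_self_eq_norm_sq_to_K]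
      simp
    exact ContinuousLinearMap.coe_inj.1 this
  · intro hS
    obtain ⟨f, hf⟩ := exists_ne (0 : H)
    have hf' : 0 < ‖f‖ ^ 2 := by have := norm_pos_iff.2 hf; positivity
    have hl : IsLowerBound x B := hS.isLowerBound_iff.2 ⟨hB, fun f => (hin f).ge⟩
    have hu : IsUpperBound x B := hS.isUpperBound_iff.2 ⟨hB, fun f => (hin f).le⟩
    refine ⟨⟨⟨B, hl⟩, B, hu⟩, ⟨hl, fun A hA => ?_⟩, hu, fun A hA => ?_⟩
    · have := (hS.isLowerBound_iff.1 hA).2 f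
      rw [hin] at this
      exact le_of_mul_le_mul_right this hf'
    · have := (hS.isUpperBound_iff.1 hA).2 f
      rw [hin] at this
      exact le_of_mul_le_mul_right this hf'

end AbstractFrames

/-- The exceptional null set may depend on `h`; a countable dense set and closedness in `h` remove
this dependence. -/
lemma ae_forall_of_isClosed {X : Type*} [TopologicalSpace X] [TopologicalSpace.SeparableSpace X]
    {P : Circle → X → Prop} (hc : ∀ ω, IsClosed {h | P ω h})
    (hP : ∀ h, ∀ᵐ ω ∂circleMeasure, P ω h) : ∀ᵐ ω ∂circleMeasure, ∀ h, P ω h := by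
  obtain ⟨D, hD, hDd⟩ := TopologicalSpace.exists_countable_dense X
  have := (ae_ball_iff hD).2 fun h _ => hP h
  filter_upwards [this] with ω hω h
  have : closure D ⊆ {h | P ω h} := closure_minimal (fun x hx => hω x hx) (hc ω)
  exact this (hDd h)

/-! ### Functions and local operators on `L²(∂𝔻; H)` -/

section CircleFunctions

variable {H : Type*} [NormedAddCommGroup H]

lemma enorm_sq_eq_lintegral (f : L2Circle H) : ‖f‖ₑ ^ 2 = ∫⁻ ω, ‖f ω‖ₑ ^ 2 ∂circleMeasure := by
  have h := eLpNorm_nnreal_pow_eq_lintegral (μ := circleMeasure) (f := f) (p := 2) two_ne_zero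
  simp only [NNReal.coe_ofNat, ENNReal.coe_ofNat, ENNReal.rpow_ofNat] at h
  rw [Lp.enorm_def, h]

/-- The function with value `h` on `E` and `0` elsewhere, in `L²(∂𝔻; H)`. -/
abbrev indConst {E : Set Circle} (hE : MeasurableSet E) (h : H) : L2Circle H :=
  indicatorConstLp 2 hE (measure_ne_top circleMeasure E) h

lemma indConst_coe {E : Set Circle} (hE : MeasurableSet E) (h : H) :
    indConst hE h =ᵐ[circleMeasure] E.indicator fun _ => h := indicatorConstLp_coeFn

lemma enorm_sq_indConst {E : Set Circle} (hE : MeasurableSet E) (h : H) :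
    ‖indConst hE h‖ₑ ^ 2 = ∫⁻ _ in E, ‖h‖ₑ ^ 2 ∂circleMeasure := by
  rw [enorm_sq_eq_lintegral, ← lintegral_indicator hE]
  refine lintegral_congr_ae ?_
  filter_upwards [indConst_coe hE h] with ω h1
  rw [h1]
  by_cases hω : ω ∈ E <;> simp [hω]

end CircleFunctions

section CircleOperators

variable {H : Type*} [NormedAddCommGroup H] [InnerProductSpace ℂ H]

lemma monomial_zero_coe (h : H) : monomial h 0 =ᵐ[circleMeasure] fun _ => h := by
  filter_upwards [monomial_coe h 0] with ω hω
  rw [hω]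
  simp

lemma monomial_add (g h : H) (m : ℤ) : monomial (g + h) m = monomial g m + monomial h m := by
  ext1
  filter_upwards [monomial_coe (g + h) m, monomial_coe g m, monomial_coe h m,
    Lp.coeFn_add (monomial g m) (monomial h m)] with ω h1 h2 h3 h4
  rw [h1, h4, Pi.add_apply, h2, h3, smul_add]

lemma monomial_smul (c : ℂ) (h : H) (m : ℤ) : monomial (c • h) m = c • monomial h m := by
  ext1
  filter_upwards [monomial_coe (c • h) m, monomial_coe h m,
    Lp.coeFn_smul c (monomial h m)] with ω h1 h2 h3
  rw [h1, h3, Pi.smul_apply, h2, smul_comm]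

lemma memLp_zpow_smul (m : ℤ) (v : L2Circle H) :
    MemLp (fun ω : Circle => ((ω ^ m : Circle) : ℂ) • v ω) 2 circleMeasure := by
  refine (Lp.memLp v).of_le
    ((continuous_zpow_circle m).aestronglyMeasurable.smul (Lp.aestronglyMeasurable v)) ?_
  filter_upwards with ω
  rw [norm_smul, Circle.norm_coe, one_mul]

/-- Multiplication by `ω ^ m` on `L²(∂𝔻; H)`. -/
def mulZpow (m : ℤ) : L2Circle H →L[ℂ] L2Circle H :=
  LinearMap.mkContinuous
    { toFun := fun v => (memLp_zpow_smul m v).toLp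
      map_add' := fun v w => by
        ext1
        filter_upwards [(memLp_zpow_smul m (v + w)).coeFn_toLp, (memLp_zpow_smul m v).coeFn_toLp,
          (memLp_zpow_smul m w).coeFn_toLp, Lp.coeFn_add v w,
          Lp.coeFn_add (memLp_zpow_smul m v).toLp (memLp_zpow_smul m w).toLp] with ω h1 h2 h3 h4 h5
        rw [h1, h5, Pi.add_apply, h2, h3, h4, Pi.add_apply, smul_add]
      map_smul' := fun c v => by
        ext1
        filter_upwards [(memLp_zpow_smul m (c • v)).coeFn_toLp, (memLp_zpow_smul m v).coeFn_toLp,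
          Lp.coeFn_smul c v, Lp.coeFn_smul c (memLp_zpow_smul m v).toLp] with ω h1 h2 h3 h4
        rw [h1, RingHom.id_apply, h4, Pi.smul_apply, h2, h3, Pi.smul_apply, smul_comm] } 1
    fun v => by
      rw [one_mul]
      refine Lp.norm_le_norm_of_ae_le ?_
      filter_upwards [(memLp_zpow_smul m v).coeFn_toLp] with ω h1
      refine (congrArg norm h1).trans_le ?_
      rw [norm_smul, Circle.norm_coe, one_mul]

lemma mulZpow_coe (m : ℤ) (v : L2Circle H) :
    mulZpow m v =ᵐ[circleMeasure] fun ω => ((ω ^ m : Circle) : ℂ) • v ω :=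
  (memLp_zpow_smul m v).coeFn_toLp

lemma mulZpow_monomial (m n : ℤ) (h : H) : mulZpow m (monomial h n) = monomial h (m + n) := by
  ext1
  filter_upwards [mulZpow_coe m (monomial h n), monomial_coe h n, monomial_coe h (m + n)]
    with ω h1 h2 h3
  rw [h1, h2, h3, smul_smul, zpow_add, Circle.coe_mul]

/-- The values of `R` on constants on measurable sets are the restrictions of the values of `R` on
constants. -/
def IsLocal (R : L2Circle H →L[ℂ] L2Circle H) : Prop :=
  ∀ (E : Set Circle) (hE : MeasurableSet E) (h : H),
    R (indConst hE h) =ᵐ[circleMeasure] E.indicator (R (monomial h 0))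

lemma HasFibers.ae_apply {R : L2Circle H →L[ℂ] L2Circle H} {s : Circle → H →L[ℂ] H}
    (hs : HasFibers R s) (h : H) : ∀ᵐ ω ∂circleMeasure, s ω h = R (monomial h 0) ω := by
  filter_upwards [hs (monomial h 0), monomial_zero_coe h] with ω h1 h2
  rw [← h1, h2]

lemma HasFibers.isLocal {R : L2Circle H →L[ℂ] L2Circle H} {s : Circle → H →L[ℂ] H}
    (hs : HasFibers R s) : IsLocal R := by
  intro E hE h
  filter_upwards [hs (indConst hE h), indConst_coe hE h, hs.ae_apply h] with ω h1 h2 h3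
  rw [← h1, h2]
  by_cases hω : ω ∈ E <;> simp [hω, h3]

lemma IsLocal.enorm_sq {R : L2Circle H →L[ℂ] L2Circle H} (hR : IsLocal R) {E : Set Circle}
    (hE : MeasurableSet E) (h : H) :
    ‖R (indConst hE h)‖ₑ ^ 2 = ∫⁻ ω in E, ‖R (monomial h 0) ω‖ₑ ^ 2 ∂circleMeasure := by
  rw [enorm_sq_eq_lintegral, ← lintegral_indicator hE]
  refine lintegral_congr_ae ?_
  filter_upwards [hR E hE h] with ω h1
  rw [h1]
  by_cases hω : ω ∈ E <;> simp [hω]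

/-- Locality turns the bound at `1_E h` into an inequality between integrals over `E`. Since `E` is
arbitrary, the integrands compare a.e. -/
lemma IsLocal.ae_enorm_le {R : L2Circle H →L[ℂ] L2Circle H} (hR : IsLocal R) {c : ℝ≥0∞}
    (hc : ∀ v, ‖R v‖ₑ ≤ c * ‖v‖ₑ) (h : H) :
    ∀ᵐ ω ∂circleMeasure, ‖R (monomial h 0) ω‖ₑ ≤ c * ‖h‖ₑ := by
  have h1 : (fun ω => ‖R (monomial h 0) ω‖ₑ ^ 2) ≤ᵐ[circleMeasure] fun _ => c ^ 2 * ‖h‖ₑ ^ 2 := by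
    refine ae_le_of_forall_setLIntegral_le_of_sigmaFinite₀
      ((Lp.aestronglyMeasurable _).enorm.pow_const 2) fun E hE _ => ?_
    rw [← hR.enorm_sq hE, lintegral_const_mul _ measurable_const, ← enorm_sq_indConst hE,
      ← mul_pow]
    gcongr
    exact hc _
  filter_upwards [h1] with ω h2
  rw [← mul_pow] at h2
  exact (ENNReal.pow_le_pow_left_iff two_ne_zero).1 h2

lemma IsLocal.ae_le_enorm {R : L2Circle H →L[ℂ] L2Circle H} (hR : IsLocal R) {c : ℝ≥0∞}
    (hc : ∀ v, c * ‖v‖ₑ ≤ ‖R v‖ₑ) (h : H) :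
    ∀ᵐ ω ∂circleMeasure, c * ‖h‖ₑ ≤ ‖R (monomial h 0) ω‖ₑ := by
  have h1 : (fun _ => c ^ 2 * ‖h‖ₑ ^ 2) ≤ᵐ[circleMeasure] fun ω => ‖R (monomial h 0) ω‖ₑ ^ 2 := by
    refine ae_le_of_forall_setLIntegral_le_of_sigmaFinite measurable_const fun E hE _ => ?_
    rw [← hR.enorm_sq hE, lintegral_const_mul _ measurable_const, ← enorm_sq_indConst hE,
      ← mul_pow]
    gcongr
    exact hc _
  filter_upwards [h1] with ω h2
  rw [← mul_pow] at h2
  exact (ENNReal.pow_le_pow_left_iff two_ne_zero).1 h2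

lemma IsLocal.setIntegral_inner {R : L2Circle H →L[ℂ] L2Circle H} (hR : IsLocal R)
    {E : Set Circle} (hE : MeasurableSet E) (h : H) :
    ∫ ω in E, inner ℂ (R (monomial h 0) ω) h ∂circleMeasure
      = inner ℂ (R (indConst hE h)) (indConst hE h) := by
  rw [L2.inner_def, ← integral_indicator hE]
  refine integral_congr_ae ?_
  filter_upwards [hR E hE h, indConst_coe hE h] with ω h1 h2
  rw [h1, h2]
  by_cases hω : ω ∈ E <;> simp [hω]

open scoped ComplexOrder in
lemma IsLocal.ae_inner_nonneg {R : L2Circle H →L[ℂ] L2Circle H} (hR : IsLocal R)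
    (hp : R.IsPositive) (h : H) :
    ∀ᵐ ω ∂circleMeasure, 0 ≤ (inner ℂ (R (monomial h 0) ω) h : ℂ) := by
  have hi : Integrable (fun ω => (inner ℂ (R (monomial h 0) ω) h : ℂ)) circleMeasure :=
    ((Lp.memLp (R (monomial h 0))).inner_const h).integrable one_le_two
  have h1 : 0 ≤ᵐ[circleMeasure] fun ω => RCLike.re (inner ℂ (R (monomial h 0) ω) h : ℂ) := by
    refine ae_nonneg_of_forall_setIntegral_nonneg hi.re fun E hE _ => ?_
    rw [integral_re hi.integrableOn, hR.setIntegral_inner hE]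
    exact hp.re_inner_nonneg_left _
  -- Over each `E` the integral is a value of the form of `R`, hence real, so the imaginary part
  -- integrates to `0` everywhere.
  have h2 : (fun ω => RCLike.im (inner ℂ (R (monomial h 0) ω) h : ℂ)) =ᵐ[circleMeasure] 0 := by
    refine hi.im.ae_eq_zero_of_forall_setIntegral_eq_zero fun E hE _ => ?_
    rw [integral_im hi.integrableOn, hR.setIntegral_inner hE]
    exact (RCLike.nonneg_iff.1 (hp.inner_nonneg_left _)).2
  filter_upwards [h1, h2] with ω h3 h4
  exact RCLike.nonneg_iff.2 ⟨h3, h4⟩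

lemma separableSpace_of_hilbertBasis {A : Type*} [Countable A] (u : HilbertBasis A ℂ H) :
    TopologicalSpace.SeparableSpace H := by
  rw [← TopologicalSpace.isSeparable_univ_iff]
  have h := ((countable_range u).isSeparable.span (R := ℂ)).closure
  rwa [← Submodule.topologicalClosure_coe, u.dense_span, Submodule.top_coe] at h

section Separable

variable [TopologicalSpace.SeparableSpace H] {R : L2Circle H →L[ℂ] L2Circle H}
  {s : Circle → H →L[ℂ] H}

/-- The constant is taken finite because multiplication by `∞` is not continuous on `ℝ≥0∞`, and
closedness in `h` is required. -/
lemma HasFibers.ae_forall_enorm_le (hs : HasFibers R s) {c : NNReal}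
    (hc : ∀ v, ‖R v‖ₑ ≤ c * ‖v‖ₑ) : ∀ᵐ ω ∂circleMeasure, ∀ h, ‖s ω h‖ₑ ≤ c * ‖h‖ₑ := by
  refine ae_forall_of_isClosed (fun ω => isClosed_le (by fun_prop)
    ((ENNReal.continuous_const_mul ENNReal.coe_ne_top).comp continuous_enorm)) fun h => ?_
  filter_upwards [hs.isLocal.ae_enorm_le hc h, hs.ae_apply h] with ω h1 h2
  rwa [h2]

lemma HasFibers.ae_forall_le_enorm (hs : HasFibers R s) {c : NNReal}
    (hc : ∀ v, c * ‖v‖ₑ ≤ ‖R v‖ₑ) : ∀ᵐ ω ∂circleMeasure, ∀ h, c * ‖h‖ₑ ≤ ‖s ω h‖ₑ := by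
  refine ae_forall_of_isClosed (fun ω => isClosed_le
    ((ENNReal.continuous_const_mul ENNReal.coe_ne_top).comp continuous_enorm)
    (by fun_prop)) fun h => ?_
  filter_upwards [hs.isLocal.ae_le_enorm hc h, hs.ae_apply h] with ω h1 h2
  rwa [h2]

open scoped ComplexOrder in
lemma HasFibers.ae_isPositive (hs : HasFibers R s) (hp : R.IsPositive) :
    ∀ᵐ ω ∂circleMeasure, (s ω).IsPositive := by
  have h1 : ∀ᵐ ω ∂circleMeasure, ∀ h, 0 ≤ (inner ℂ (s ω h) h : ℂ) := by
    refine ae_forall_of_isClosed (fun ω => isClosed_le continuous_const (by fun_prop)) fun h => ?_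
    filter_upwards [hs.isLocal.ae_inner_nonneg hp h, hs.ae_apply h] with ω h1 h2
    rwa [h2]
  filter_upwards [h1] with ω h2
  rw [ContinuousLinearMap.isPositive_iff_complex]
  intro h
  obtain ⟨h3, h4⟩ := RCLike.nonneg_iff.1 (h2 h)
  exact ⟨Complex.ext rfl h4.symm, h3⟩

end Separable

lemma HasFibers.enorm_apply_le {R : L2Circle H →L[ℂ] L2Circle H} {s : Circle → H →L[ℂ] H}
    (hs : HasFibers R s) {c : NNReal}
    (hc : ∀ᵐ ω ∂circleMeasure, ∀ h, ‖s ω h‖ₑ ≤ c * ‖h‖ₑ) (v : L2Circle H) :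
    ‖R v‖ₑ ≤ c * ‖v‖ₑ := by
  rw [← ENNReal.pow_le_pow_left_iff two_ne_zero, mul_pow, enorm_sq_eq_lintegral,
    enorm_sq_eq_lintegral, ← lintegral_const_mul' _ _ (by simp)]
  refine lintegral_mono_ae ?_
  filter_upwards [hs v, hc] with ω h1 h2
  rw [← h1, ← mul_pow]
  gcongr
  exact h2 _

lemma HasFibers.le_enorm_apply {R : L2Circle H →L[ℂ] L2Circle H} {s : Circle → H →L[ℂ] H}
    (hs : HasFibers R s) {c : NNReal}
    (hc : ∀ᵐ ω ∂circleMeasure, ∀ h, c * ‖h‖ₑ ≤ ‖s ω h‖ₑ) (v : L2Circle H) :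
    c * ‖v‖ₑ ≤ ‖R v‖ₑ := by
  rw [← ENNReal.pow_le_pow_left_iff two_ne_zero, mul_pow, enorm_sq_eq_lintegral,
    enorm_sq_eq_lintegral, ← lintegral_const_mul' _ _ (by simp)]
  refine lintegral_mono_ae ?_
  filter_upwards [hs v, hc] with ω h1 h2
  rw [← h1, ← mul_pow]
  gcongr
  exact h2 _

end CircleOperators

/-! ### Decomposability of operators commuting with the powers of `ω` -/

section Decomposable

variable {H : Type*} [NormedAddCommGroup H] [InnerProductSpace ℂ H]
  {R : L2Circle H →L[ℂ] L2Circle H}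

lemma inner_mulZpow (m : ℤ) (h : H) (n : ℤ) (v : L2Circle H) :
    inner ℂ (monomial h n) (mulZpow m v) = inner ℂ (monomial h (n - m)) v := by
  rw [L2.inner_def, L2.inner_def]
  refine integral_congr_ae ?_
  filter_upwards [monomial_coe h n, monomial_coe h (n - m), mulZpow_coe m v] with ω h1 h2 h3
  rw [h1, h2, h3, inner_smul_left, inner_smul_left, inner_smul_right, ← mul_assoc,
    ← Circle.coe_inv_eq_conj, ← Circle.coe_inv_eq_conj, ← Circle.coe_mul, ← zpow_neg, ← zpow_neg,
    ← zpow_add]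
  congr 4
  ring

/-- A fiberwise adjoint relation, available before any fibers exist: commutation with the powers of
`ω` gives both functions the same Fourier coefficients. -/
lemma ae_inner_adjoint_eq [CompleteSpace H] (hR : ∀ m v, R (mulZpow m v) = mulZpow m (R v))
    (k h : H) : ∀ᵐ ω ∂circleMeasure, inner ℂ (R.adjoint (monomial k 0) ω) h
      = (inner ℂ k (R (monomial h 0) ω) : ℂ) := by
  have h0 := ae_zero_of_coeff (fun ω => inner ℂ (R.adjoint (monomial k 0) ω) h
      - (inner ℂ k (R (monomial h 0) ω) : ℂ))
    (((Lp.memLp _).inner_const h).sub ((Lp.memLp _).const_inner k)) fun m => by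
      have h1 : (inner ℂ (R.adjoint (monomial k 0)) (monomial h (-m)) : ℂ)
          = inner ℂ (monomial k 0) (mulZpow (-m) (R (monomial h 0))) := by
        rw [ContinuousLinearMap.adjoint_inner_left, ← hR, mulZpow_monomial, add_zero]
      rw [L2.inner_def, L2.inner_def, ← sub_eq_zero,
        ← integral_sub (L2.integrable_inner _ _) (L2.integrable_inner _ _)] at h1
      rw [← h1]
      refine integral_congr_ae ?_
      filter_upwards [monomial_coe h (-m), monomial_zero_coe k,
        mulZpow_coe (-m) (R (monomial h 0))] with ω h2 h3 h4
      rw [h2, h3, h4, inner_smul_right, inner_smul_right, mul_sub]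
  filter_upwards [h0] with ω h1
  exact sub_eq_zero.1 h1

variable {A : Type*}

/-- Both sides are tested against `ω^n u_a`. Moving `R` to the adjoint leaves an integral over `E`,
where `ae_inner_adjoint_eq` applies; no approximation of `1_E` by trigonometric polynomials is
needed. -/
lemma isLocal_of_comm [CompleteSpace H] [Countable A] (u : HilbertBasis A ℂ H)
    (hR : ∀ m v, R (mulZpow m v) = mulZpow m (R v)) : IsLocal R := by
  intro E hE h
  have hm : MemLp (E.indicator (R (monomial h 0))) 2 circleMeasure := (Lp.memLp _).indicator hE
  suffices hw : R (indConst hE h) = hm.toLp by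
    rw [hw]; exact hm.coeFn_toLp
  rw [← sub_eq_zero, ← Submodule.mem_bot ℂ, ← monomial_complete u]
  refine (Submodule.mem_orthogonal _ _).2 fun x hx => ?_
  induction hx using Submodule.span_induction with
  | zero => simp
  | add x y _ _ hx hy => rw [inner_add_left, hx, hy, add_zero]
  | smul c x _ hx => rw [inner_smul_left, hx, mul_zero]
  | mem x hx =>
    obtain ⟨⟨a, n⟩, rfl⟩ := hx
    change inner ℂ (monomial (u a) n) _ = 0
    rw [inner_sub_right, sub_eq_zero]
    have e1 : (inner ℂ (monomial (u a) n) (R (indConst hE h)) : ℂ)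
        = inner ℂ (R.adjoint (monomial (u a) 0)) (mulZpow (-n) (indConst hE h)) := by
      rw [ContinuousLinearMap.adjoint_inner_left, hR, inner_mulZpow, zero_sub, neg_neg]
    have e2 : (inner ℂ (monomial (u a) n) hm.toLp : ℂ)
        = inner ℂ (monomial (u a) 0) (mulZpow (-n) hm.toLp) := by
      rw [inner_mulZpow, zero_sub, neg_neg]
    rw [e1, e2, L2.inner_def, L2.inner_def]
    refine integral_congr_ae ?_
    filter_upwards [mulZpow_coe (-n) (indConst hE h), mulZpow_coe (-n) hm.toLp,
      indConst_coe hE h, hm.coeFn_toLp, monomial_zero_coe (u a),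
      ae_inner_adjoint_eq hR (u a) h] with ω h1 h2 h3 h4 h5 h6
    rw [h1, h2, h3, h4, h5, inner_smul_right, inner_smul_right]
    by_cases hω : ω ∈ E <;> simp [hω, h6]

lemma ae_linearCombination_eq (u : A → H) (c : A →₀ ℂ) :
    ∀ᵐ ω ∂circleMeasure, Finsupp.linearCombination ℂ (fun a => R (monomial (u a) 0) ω) c
      = R (monomial (Finsupp.linearCombination ℂ u c) 0) ω := by
  induction c using Finsupp.induction_linear with
  | zero =>
    have : monomial (0 : H) 0 = 0 := by simpa using monomial_smul (0 : ℂ) (0 : H) 0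
    simp only [map_zero, this]
    filter_upwards [Lp.coeFn_zero H 2 circleMeasure] with ω h1
    rw [h1, Pi.zero_apply]
  | add f g hf hg =>
    simp only [map_add, monomial_add]
    filter_upwards [hf, hg, Lp.coeFn_add (R (monomial (Finsupp.linearCombination ℂ u f) 0))
      (R (monomial (Finsupp.linearCombination ℂ u g) 0))] with ω h1 h2 h3
    rw [h1, h2, h3, Pi.add_apply]
  | single a b =>
    simp only [Finsupp.linearCombination_single, monomial_smul, map_smul]
    filter_upwards [Lp.coeFn_smul b (R (monomial (u a) 0))] with ω h1
    rw [h1, Pi.smul_apply]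

/-- The null set must serve all coefficients at once. For a finite set `T` of indices they range
over the separable space `ℂ^T`, where both sides are continuous, and there are only countably many
`T`. -/
lemma IsLocal.ae_forall_linearCombination_le [Countable A] (hR : IsLocal R) (u : A → H) :
    ∀ᵐ ω ∂circleMeasure, ∀ c : A →₀ ℂ,
      ‖Finsupp.linearCombination ℂ (fun a => R (monomial (u a) 0) ω) c‖
        ≤ ‖R‖ * ‖Finsupp.linearCombination ℂ u c‖ := by
  let L : ∀ T : Finset A, (T → ℂ) →ₗ[ℂ] (A →₀ ℂ) := fun T =>
    Fintype.linearCombination ℂ (fun a : T => Finsupp.single (a : A) (1 : ℂ))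
  have h1 : ∀ T : Finset A, ∀ᵐ ω ∂circleMeasure, ∀ d : T → ℂ,
      ‖Finsupp.linearCombination ℂ (fun a => R (monomial (u a) 0) ω) (L T d)‖
        ≤ ‖R‖ * ‖Finsupp.linearCombination ℂ u (L T d)‖ := by
    intro T
    refine ae_forall_of_isClosed (fun ω => isClosed_le
      ((Finsupp.linearCombination ℂ (fun a => R (monomial (u a) 0) ω)
        ∘ₗ L T).continuous_of_finiteDimensional.norm)
      (continuous_const.mul (Finsupp.linearCombination ℂ u
        ∘ₗ L T).continuous_of_finiteDimensional.norm)) fun d => ?_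
    filter_upwards [ae_linearCombination_eq (R := R) u (L T d),
      hR.ae_enorm_le R.le_opENorm (Finsupp.linearCombination ℂ u (L T d))] with ω h2 h3
    rw [h2]
    rwa [enorm_eq_nnnorm, enorm_eq_nnnorm, enorm_eq_nnnorm, ← ENNReal.coe_mul,
      ENNReal.coe_le_coe] at h3
  filter_upwards [ae_all_iff.2 h1] with ω h2 c
  have h3 : L c.support (fun a => c a) = c := by
    rw [Fintype.linearCombination_apply,
      Finset.sum_coe_sort c.support (fun a => c a • Finsupp.single a (1 : ℂ))]
    simpa [Finsupp.sum] using c.sum_single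
  have h4 := h2 c.support fun a => c a
  rwa [h3] at h4

lemma isClosed_setOf_ae_apply_eq (s : Circle → H →L[ℂ] H) :
    IsClosed {v : L2Circle H | ∀ᵐ ω ∂circleMeasure, s ω (v ω) = R v ω} := by
  refine IsSeqClosed.isClosed fun f v hf hv => ?_
  -- Two successive extractions give one subsequence along which both `f` and `R f` converge a.e.
  -- Continuity of each single `s ω` then suffices, without a uniform bound.
  obtain ⟨n₁, hn₁, h₁⟩ := (tendstoInMeasure_of_tendsto_Lp hv).exists_seq_tendsto_ae
  obtain ⟨n₂, hn₂, h₂⟩ := (tendstoInMeasure_of_tendsto_Lp (((R.continuous.tendsto v).comp hv).comp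
    hn₁.tendsto_atTop)).exists_seq_tendsto_ae
  filter_upwards [h₁, h₂, ae_all_iff.2 hf] with ω h3 h4 h5
  have h6 := ((s ω).continuous.tendsto (v ω)).comp (h3.comp hn₂.tendsto_atTop)
  refine tendsto_nhds_unique (h6.congr fun i => ?_) h4
  exact h5 _

/-- An operator that commutes with the multiplications by the powers of `ω` is decomposable. -/
theorem isDecomposable_of_comm [CompleteSpace H] [Countable A] (u : HilbertBasis A ℂ H)
    (hR : ∀ m v, R (mulZpow m v) = mulZpow m (R v)) :
    IsDecomposable R := by
  have hd : DenseRange (Finsupp.linearCombination ℂ u) := by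
    rw [DenseRange, ← LinearMap.coe_range, Finsupp.range_linearCombination,
      Submodule.dense_iff_topologicalClosure_eq_top, u.dense_span]
  -- The fiber is the continuous extension of `u_a ↦ (R u_a)(ω)`. Its value on the null set where
  -- the bound by `‖R‖` fails plays no role.
  let s : Circle → H →L[ℂ] H := fun ω =>
    (Finsupp.linearCombination ℂ (fun a => R (monomial (u a) 0) ω)).extendOfNorm
      (Finsupp.linearCombination ℂ u)
  have h1 : ∀ᵐ ω ∂circleMeasure, ∀ a, s ω (u a) = R (monomial (u a) 0) ω := by
    filter_upwards [(isLocal_of_comm u hR).ae_forall_linearCombination_le u] with ω h2 a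
    have := LinearMap.extendOfNorm_eq hd ⟨‖R‖, h2⟩ (Finsupp.single a 1)
    simpa using this
  refine ⟨s, fun v => ?_⟩
  have hs : Dense (Submodule.span ℂ (range fun p : A × ℤ => monomial (u p.1) p.2)
      : Set (L2Circle H)) := by
    rw [Submodule.dense_iff_topologicalClosure_eq_top, Submodule.topologicalClosure_eq_top_iff,
      monomial_complete u]
  -- The vectors on which the fibers act correctly form a closed subspace, so the monomials `ω^n
  -- u_a` suffice.
  refine closure_minimal (fun x hx => ?_) (isClosed_setOf_ae_apply_eq (R := R) s) (hs v)
  change ∀ᵐ ω ∂circleMeasure, s ω (x ω) = R x ω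
  induction hx using Submodule.span_induction with
  | zero =>
    rw [map_zero]
    filter_upwards [Lp.coeFn_zero H 2 circleMeasure] with ω h2
    rw [h2, Pi.zero_apply, map_zero]
  | add x y _ _ hx hy =>
    rw [map_add]
    filter_upwards [hx, hy, Lp.coeFn_add x y, Lp.coeFn_add (R x) (R y)] with ω h2 h3 h4 h5
    rw [h4, h5, Pi.add_apply, Pi.add_apply, map_add, h2, h3]
  | smul c x _ hx =>
    rw [map_smul]
    filter_upwards [hx, Lp.coeFn_smul c x, Lp.coeFn_smul c (R x)] with ω h2 h4 h5
    rw [h4, h5, Pi.smul_apply, Pi.smul_apply, map_smul, h2]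
  | mem x hx =>
    obtain ⟨⟨a, n⟩, rfl⟩ := hx
    change ∀ᵐ ω ∂circleMeasure, s ω (monomial (u a) n ω) = R (monomial (u a) n) ω
    have h2 : R (monomial (u a) n) = mulZpow n (R (monomial (u a) 0)) := by
      rw [← hR, mulZpow_monomial, add_zero]
    rw [h2]
    filter_upwards [h1, monomial_coe (u a) n, mulZpow_coe n (R (monomial (u a) 0))]
      with ω h3 h4 h5
    rw [h4, h5, map_smul, h3]

end Decomposable

/-! ### Operator norms and essential bounds of fibers -/

section FiberBounds

variable {H : Type*} [NormedAddCommGroup H] [InnerProductSpace ℂ H]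

lemma exists_unit_enorm_apply (h : H) (hh : h ≠ 0) :
    ∃ v : H, ‖v‖ = 1 ∧ ∀ T : H →L[ℂ] H, ‖T h‖ₑ = ‖T v‖ₑ * ‖h‖ₑ := by
  have h0 : (‖h‖ : ℂ) ≠ 0 := by simpa using hh
  have h1 : ‖(‖h‖ : ℂ)‖ₑ = ‖h‖ₑ := by rw [← ofReal_norm, Complex.norm_real, norm_norm, ofReal_norm]
  refine ⟨((‖h‖ : ℂ)⁻¹) • h, by rw [norm_smul]; simp [hh], fun T => ?_⟩
  rw [map_smul, enorm_smul, enorm_inv h0, h1, mul_right_comm,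
    ENNReal.inv_mul_cancel (by simpa using hh) (by simp), one_mul]

lemma iSup_unit_enorm_le_iff (T : H →L[ℂ] H) (c : ℝ≥0∞) :
    (⨆ (v : H) (_ : ‖v‖ = 1), ‖T v‖ₑ) ≤ c ↔ ∀ h, ‖T h‖ₑ ≤ c * ‖h‖ₑ := by
  rw [iSup₂_le_iff]
  refine ⟨fun H h => ?_, fun H v hv => ?_⟩
  · by_cases hh : h = 0
    · simp [hh]
    · obtain ⟨v, hv, hT⟩ := exists_unit_enorm_apply h hh
      rw [hT]
      gcongr
      exact H v hv
  · have := H v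
    rwa [← ofReal_norm v, hv, ENNReal.ofReal_one, mul_one] at this

lemma le_iInf_unit_enorm_iff (T : H →L[ℂ] H) (c : ℝ≥0∞) :
    c ≤ (⨅ (v : H) (_ : ‖v‖ = 1), ‖T v‖ₑ) ↔ ∀ h, c * ‖h‖ₑ ≤ ‖T h‖ₑ := by
  rw [le_iInf₂_iff]
  refine ⟨fun H h => ?_, fun H v hv => ?_⟩
  · by_cases hh : h = 0
    · simp [hh]
    · obtain ⟨v, hv, hT⟩ := exists_unit_enorm_apply h hh
      rw [hT]
      gcongr
      exact H v hv
  · have := H v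
    rwa [← ofReal_norm v, hv, ENNReal.ofReal_one, mul_one] at this

lemma enorm_le_coe_iff (T : H →L[ℂ] H) (c : NNReal) :
    ‖T‖ₑ ≤ c ↔ ∀ h, ‖T h‖ₑ ≤ c * ‖h‖ₑ := by
  simp only [enorm_eq_nnnorm, ← ENNReal.coe_mul, ENNReal.coe_le_coe,
    ContinuousLinearMap.opNNNorm_le_iff]

lemma iSup_unit_enorm (T : H →L[ℂ] H) : (⨆ (v : H) (_ : ‖v‖ = 1), ‖T v‖ₑ) = ‖T‖ₑ :=
  ENNReal.eq_of_forall_le_nnreal_iff fun c => by rw [iSup_unit_enorm_le_iff, enorm_le_coe_iff]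

lemma essSupFiber_eq (s : Circle → H →L[ℂ] H) :
    essSupFiber s = essSup (fun ω => ‖s ω‖ₑ) circleMeasure := by
  simp only [essSupFiber, iSup_unit_enorm]

/-- Norm identities are obtained by comparing the finite constants below or above each side. No
measurability of the fiber norms in `ω` enters. -/
lemma essSupFiber_le_iff (s : Circle → H →L[ℂ] H) (c : NNReal) :
    essSupFiber s ≤ c ↔ ∀ᵐ ω ∂circleMeasure, ∀ h, ‖s ω h‖ₑ ≤ c * ‖h‖ₑ := by
  simp only [← iSup_unit_enorm_le_iff]
  refine ⟨fun h => ?_, fun h => essSup_le_of_ae_le _ h⟩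
  filter_upwards [ENNReal.ae_le_essSup (μ := circleMeasure)
    fun ω => ⨆ (v : H) (_ : ‖v‖ = 1), ‖s ω v‖ₑ] with ω hω
  exact hω.trans h

lemma le_essInfFiber_iff (s : Circle → H →L[ℂ] H) (c : NNReal) :
    c ≤ essInfFiber s ↔ ∀ᵐ ω ∂circleMeasure, ∀ h, c * ‖h‖ₑ ≤ ‖s ω h‖ₑ := by
  simp only [← le_iInf_unit_enorm_iff]
  refine ⟨fun h => ?_, fun h => le_essInf_of_ae_le _ h⟩
  filter_upwards [ae_essInf_le (μ := circleMeasure)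
    (f := fun ω => ⨅ (v : H) (_ : ‖v‖ = 1), ‖s ω v‖ₑ)] with ω hω
  exact h.trans hω

/-- Identifies `‖S⁻¹‖⁻¹` as the best constant in `c ‖f‖ ≤ ‖S f‖`, the form in which it can be
compared with `β`. -/
lemma coe_le_inv_enorm_iff {S R : H →L[ℂ] H} (hSR : S ∘L R = ContinuousLinearMap.id ℂ H)
    (hRS : R ∘L S = ContinuousLinearMap.id ℂ H) (c : NNReal) :
    c ≤ ‖R‖ₑ⁻¹ ↔ ∀ f, c * ‖f‖ₑ ≤ ‖S f‖ₑ := by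
  have h1 : ∀ f, R (S f) = f := DFunLike.congr_fun hRS
  have h2 : ∀ f, S (R f) = f := DFunLike.congr_fun hSR
  constructor
  · intro hc f
    calc c * ‖f‖ₑ = c * ‖R (S f)‖ₑ := by rw [h1]
      _ ≤ c * (‖R‖ₑ * ‖S f‖ₑ) := by gcongr; exact R.le_opENorm _
      _ ≤ ‖R‖ₑ⁻¹ * ‖R‖ₑ * ‖S f‖ₑ := by rw [← mul_assoc]; gcongr
      _ ≤ 1 * ‖S f‖ₑ := by gcongr; exact ENNReal.inv_mul_le_one _
      _ = _ := one_mul _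
  · intro h
    rcases eq_or_ne c 0 with rfl | hc
    · simp
    rw [ENNReal.le_inv_iff_le_inv, ← ENNReal.coe_inv hc, enorm_le_coe_iff]
    intro f
    rw [ENNReal.coe_inv hc, mul_comm, ← div_eq_mul_inv, ENNReal.le_div_iff_mul_le
      (Or.inl (by simpa using hc)) (Or.inl (by simp)), mul_comm]
    simpa [h2] using h (R f)

end FiberBounds

/-! ### Transfer through the dilation representation -/

section DilationRepresentation

lemma dilOp_zpow_add (m n : ℤ) (f : L2R) :
    (dilOp ^ (m + n) : L2R ≃ₗᵢ[ℂ] L2R) f = (dilOp ^ m) ((dilOp ^ n) f) := by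
  rw [zpow_add]; rfl

/-- `D^m` permutes the system by `k ↦ m + k`. -/
lemma IsFrameOperator.comm_dilOp_zpow {ι : Type*} {ψ : ι → L2R} {S : L2R →L[ℂ] L2R}
    (hS : IsFrameOperator (waveletSystem ψ) S) (m : ℤ) (f : L2R) :
    S ((dilOp ^ m) f) = (dilOp ^ m) (S f) :=
  hS.comm (dilOp ^ m) ((Equiv.refl ι).prodCongr ((Equiv.addLeft m).prodCongr (Equiv.refl ℤ)))
    (fun p => (dilOp_zpow_add m p.2.1 _).symm) f

lemma inverse_comm_dilOp_zpow {S R : L2R →L[ℂ] L2R}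
    (hS : ∀ (m : ℤ) f, S ((dilOp ^ m) f) = (dilOp ^ m) (S f))
    (hSR : S ∘L R = ContinuousLinearMap.id ℂ L2R) (hRS : R ∘L S = ContinuousLinearMap.id ℂ L2R)
    (m : ℤ) (f : L2R) : R ((dilOp ^ m) f) = (dilOp ^ m) (R f) := by
  have h1 : ∀ f, R (S f) = f := DFunLike.congr_fun hRS
  have h2 : ∀ f, S (R f) = f := DFunLike.congr_fun hSR
  rw [← h1 ((dilOp ^ m) (R f)), hS, h2]

instance : Nontrivial L2R := by
  refine ⟨indicatorConstLp 2 (measurableSet_Icc (a := (0 : ℝ)) (b := 1)) (by simp) 1, 0, ?_⟩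
  rw [← norm_ne_zero_iff, norm_indicatorConstLp (by simp) (by simp)]
  simp

variable {J : Type*} [Countable J] (Kp : HilbertBasis J ℂ (L2On (Ico 1 2)))
  (Km : HilbertBasis J ℂ (L2On (Ioc (-2) (-1)))) (u : HilbertBasis (J ⊕ J) ℂ (FiberSpace J))

/-- `D^m` is unitary and shifts the basis `D^n K_{s,j}` in `n`; reindexing the defining series moves
the shift onto the powers of `ω`. -/
lemma dilationTransform_dilOp_zpow (m : ℤ) (f : L2R) :
    dilationTransform Kp Km u ((dilOp ^ m) f) = mulZpow m (dilationTransform Kp Km u f) := by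
  have h1 := (hasSum_dilationTransform Kp Km u f).mapL (mulZpow m)
  have h2 := hasSum_dilationTransform Kp Km u ((dilOp ^ m) f)
  rw [← ((Equiv.refl (J ⊕ J)).prodCongr (Equiv.addLeft m)).hasSum_iff] at h2
  refine h2.unique ?_
  convert h1 using 2 with p
  change inner ℂ ((dilOp ^ (m + p.2)) (baseK Kp Km p.1)) ((dilOp ^ m) f)
    • monomial (u p.1) (m + p.2) = _
  rw [dilOp_zpow_add, LinearIsometryEquiv.inner_map_map, map_smul, mulZpow_monomial]

lemma dilationRep_apply (S : L2R →L[ℂ] L2R) (v : L2Circle (FiberSpace J)) :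
    dilationRep Kp Km u S v
      = dilationTransform Kp Km u (S ((dilationTransform Kp Km u).symm v)) := rfl

lemma dilationRep_dilationTransform (S : L2R →L[ℂ] L2R) (f : L2R) :
    dilationRep Kp Km u S (dilationTransform Kp Km u f) = dilationTransform Kp Km u (S f) := by
  rw [dilationRep_apply, LinearIsometryEquiv.symm_apply_apply]

lemma dilationRep_comm {S : L2R →L[ℂ] L2R}
    (hS : ∀ (m : ℤ) f, S ((dilOp ^ m) f) = (dilOp ^ m) (S f)) (m : ℤ)
    (v : L2Circle (FiberSpace J)) :
    dilationRep Kp Km u S (mulZpow m v) = mulZpow m (dilationRep Kp Km u S v) := by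
  obtain ⟨f, rfl⟩ := (dilationTransform Kp Km u).surjective v
  rw [← dilationTransform_dilOp_zpow, dilationRep_dilationTransform,
    dilationRep_dilationTransform, ← dilationTransform_dilOp_zpow, hS]

lemma isDecomposable_dilationRep {S : L2R →L[ℂ] L2R}
    (hS : ∀ (m : ℤ) f, S ((dilOp ^ m) f) = (dilOp ^ m) (S f)) :
    IsDecomposable (dilationRep Kp Km u S) :=
  isDecomposable_of_comm u (dilationRep_comm Kp Km u hS)

lemma dilationRep_isPositive {S : L2R →L[ℂ] L2R} (hS : S.IsPositive) :
    (dilationRep Kp Km u S).IsPositive := by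
  rw [ContinuousLinearMap.isPositive_iff_complex] at hS ⊢
  intro v
  obtain ⟨f, rfl⟩ := (dilationTransform Kp Km u).surjective v
  rw [dilationRep_dilationTransform, LinearIsometryEquiv.inner_map_map]
  exact hS f

lemma enorm_dilationTransform (f : L2R) : ‖dilationTransform Kp Km u f‖ₑ = ‖f‖ₑ := by
  rw [← ofReal_norm, LinearIsometryEquiv.norm_map, ofReal_norm]

variable {Kp Km u} {S R : L2R →L[ℂ] L2R} {s : Circle → FiberSpace J →L[ℂ] FiberSpace J}

lemma essSupFiber_dilationRep_le_iff (hs : HasFibers (dilationRep Kp Km u S) s) (c : NNReal) :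
    essSupFiber s ≤ c ↔ ∀ f, ‖S f‖ₑ ≤ c * ‖f‖ₑ := by
  have := separableSpace_of_hilbertBasis u
  rw [essSupFiber_le_iff]
  refine ⟨fun h f => ?_, fun h => hs.ae_forall_enorm_le fun v => ?_⟩
  · have := hs.enorm_apply_le h (dilationTransform Kp Km u f)
    rwa [dilationRep_dilationTransform, enorm_dilationTransform, enorm_dilationTransform] at this
  · obtain ⟨f, rfl⟩ := (dilationTransform Kp Km u).surjective v
    rw [dilationRep_dilationTransform, enorm_dilationTransform, enorm_dilationTransform]
    exact h f

lemma le_essInfFiber_dilationRep_iff (hs : HasFibers (dilationRep Kp Km u S) s) (c : NNReal) :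
    c ≤ essInfFiber s ↔ ∀ f, c * ‖f‖ₑ ≤ ‖S f‖ₑ := by
  have := separableSpace_of_hilbertBasis u
  rw [le_essInfFiber_iff]
  refine ⟨fun h f => ?_, fun h => hs.ae_forall_le_enorm fun v => ?_⟩
  · have := hs.le_enorm_apply h (dilationTransform Kp Km u f)
    rwa [dilationRep_dilationTransform, enorm_dilationTransform, enorm_dilationTransform] at this
  · obtain ⟨f, rfl⟩ := (dilationTransform Kp Km u).surjective v
    rw [dilationRep_dilationTransform, enorm_dilationTransform, enorm_dilationTransform]
    exact h f

lemma enorm_eq_essSupFiber (hs : HasFibers (dilationRep Kp Km u S) s) :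
    ‖S‖ₑ = essSupFiber s :=
  ENNReal.eq_of_forall_le_nnreal_iff fun c => by
    rw [enorm_le_coe_iff, essSupFiber_dilationRep_le_iff hs]

lemma enorm_inverse_eq_inv_essInfFiber (hs : HasFibers (dilationRep Kp Km u S) s)
    (hSR : S ∘L R = ContinuousLinearMap.id ℂ L2R) (hRS : R ∘L S = ContinuousLinearMap.id ℂ L2R) :
    ‖R‖ₑ = (essInfFiber s)⁻¹ := by
  rw [← inv_inv ‖R‖ₑ]
  congr 1
  exact ENNReal.eq_of_forall_nnreal_le_iff fun c => by
    rw [coe_le_inv_enorm_iff hSR hRS, le_essInfFiber_dilationRep_iff hs]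

/-- The condition `α < ∞` is automatic since `α = ‖S‖`; the content is that `β > 0` means `S` is
bounded below. -/
lemma IsFrameOperator.isFrame_iff_fibers {I : Type*} {x : I → L2R} (hS : IsFrameOperator x S)
    (hs : HasFibers (dilationRep Kp Km u S) s) :
    IsFrame x ↔ essSupFiber s < ∞ ∧ 0 < essInfFiber s := by
  rw [hS.isFrame_iff_bddBelow, ← enorm_eq_essSupFiber hs]
  simp only [← le_essInfFiber_dilationRep_iff hs, enorm_lt_top, true_and]
  constructor
  · rintro ⟨c, hc, h⟩
    exact (ENNReal.coe_pos.2 hc).trans_le h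
  · intro h
    obtain ⟨c, hc, h⟩ := ENNReal.lt_iff_exists_nnreal_btwn.1 h
    exact ⟨c, ENNReal.coe_pos.1 hc, h.le⟩

lemma ae_comp_eq_id {s' : Circle → FiberSpace J →L[ℂ] FiberSpace J}
    (hSR : S ∘L R = ContinuousLinearMap.id ℂ L2R)
    (hs : HasFibers (dilationRep Kp Km u S) s) (hs' : HasFibers (dilationRep Kp Km u R) s') :
    ∀ᵐ ω ∂circleMeasure, s ω * s' ω = 1 := by
  have := separableSpace_of_hilbertBasis u
  have h1 : ∀ᵐ ω ∂circleMeasure, ∀ h, s ω (s' ω h) = h := by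
    refine ae_forall_of_isClosed (fun ω => isClosed_eq (by fun_prop) continuous_id) fun h => ?_
    filter_upwards [hs'.ae_apply h, hs (dilationRep Kp Km u R (monomial h 0)),
      monomial_zero_coe h] with ω h2 h3 h4
    have h5 : dilationRep Kp Km u S (dilationRep Kp Km u R (monomial h 0)) = monomial h 0 := by
      rw [dilationRep_apply _ _ _ R, dilationRep_dilationTransform]
      have : S (R ((dilationTransform Kp Km u).symm (monomial h 0))) = _ :=
        DFunLike.congr_fun hSR _
      rw [this, ContinuousLinearMap.id_apply, LinearIsometryEquiv.apply_symm_apply]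
    rw [h2, h3, h5, h4]
  filter_upwards [h1] with ω h2
  ext1 h
  exact h2 h

lemma ae_isUnit_and_hasFibers_inverse
    (hR : ∀ (m : ℤ) f, R ((dilOp ^ m) f) = (dilOp ^ m) (R f))
    (hSR : S ∘L R = ContinuousLinearMap.id ℂ L2R) (hRS : R ∘L S = ContinuousLinearMap.id ℂ L2R)
    (hs : HasFibers (dilationRep Kp Km u S) s) :
    (∀ᵐ ω ∂circleMeasure, IsUnit (s ω)) ∧
      HasFibers (dilationRep Kp Km u R) (fun ω => Ring.inverse (s ω)) := by
  -- The inverse also commutes with `D`, so it has fibers of its own; these are a.e. two-sided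
  -- inverses of the `s ω`. The value `0` of `Ring.inverse` at non-units matters only on a null set.
  obtain ⟨s', hs'⟩ := isDecomposable_dilationRep Kp Km u hR
  have h1 := ae_comp_eq_id hSR hs hs'
  have h2 := ae_comp_eq_id hRS hs' hs
  constructor
  · filter_upwards [h1, h2] with ω h3 h4
    exact ⟨⟨s ω, s' ω, h3, h4⟩, rfl⟩
  · intro v
    filter_upwards [h1, h2, hs' v] with ω h3 h4 h5
    rw [← h5]
    congr 1
    exact Ring.inverse_unit ⟨s ω, s' ω, h3, h4⟩

lemma hasFibers_const_smul_id_iff {B : ℂ} :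
    HasFibers (dilationRep Kp Km u S) (fun _ => B • ContinuousLinearMap.id ℂ (FiberSpace J)) ↔
      S = B • ContinuousLinearMap.id ℂ L2R := by
  constructor
  · intro h
    ext1 f
    apply (dilationTransform Kp Km u).injective
    rw [← dilationRep_dilationTransform, smul_apply, ContinuousLinearMap.id_apply, map_smul]
    ext1
    filter_upwards [h (dilationTransform Kp Km u f),
      Lp.coeFn_smul B (dilationTransform Kp Km u f)] with ω h1 h2
    rw [← h1, h2]
    rfl
  · rintro rfl v
    rw [dilationRep_apply, smul_apply, ContinuousLinearMap.id_apply, map_smul,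
      LinearIsometryEquiv.apply_symm_apply]
    filter_upwards [Lp.coeFn_smul B v] with ω h2
    rw [h2]
    rfl

end DilationRepresentation

end WaveletFrame

end

open WaveletFrame

theorem theorem1 {ι J : Type*} [Countable ι] [Countable J]
    (Kp : HilbertBasis J ℂ (L2On (Set.Ico 1 2)))
    (Km : HilbertBasis J ℂ (L2On (Set.Ioc (-2) (-1))))
    (u : HilbertBasis (J ⊕ J) ℂ (FiberSpace J))
    (ψ : ι → L2R) (hψ : BddAbove (Set.range fun i => ‖ψ i‖)) :
    -- Part 1
    ((IsBessel (waveletSystem ψ) ↔ ∃ S, IsFrameOperator (waveletSystem ψ) S) ∧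
      ∀ S, IsFrameOperator (waveletSystem ψ) S →
        (∀ f, S (dilOp f) = dilOp (S f)) ∧
        IsDecomposable (dilationRep Kp Km u S) ∧
        S.IsPositive ∧
        ∀ s, HasFibers (dilationRep Kp Km u S) s →
          (∀ᵐ ω ∂circleMeasure, (s ω).IsPositive) ∧
          ‖S‖ₑ = essSup (fun ω => ‖s ω‖ₑ) circleMeasure ∧
          ‖S‖ₑ = essSupFiber s ∧
          essSupFiber s < ∞) ∧
    -- Part 2
    ((IsFrame (waveletSystem ψ) ↔
        ∃ S R, IsFrameOperator (waveletSystem ψ) S ∧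
          S ∘L R = ContinuousLinearMap.id ℂ L2R ∧ R ∘L S = ContinuousLinearMap.id ℂ L2R) ∧
      (∀ S R, IsFrameOperator (waveletSystem ψ) S →
        S ∘L R = ContinuousLinearMap.id ℂ L2R → R ∘L S = ContinuousLinearMap.id ℂ L2R →
        (∀ f, R (dilOp f) = dilOp (R f)) ∧
        ∀ s, HasFibers (dilationRep Kp Km u S) s →
          (∀ᵐ ω ∂circleMeasure, IsUnit (s ω)) ∧
          HasFibers (dilationRep Kp Km u R) (fun ω => Ring.inverse (s ω)) ∧
          ‖S‖ₑ = essSupFiber s ∧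
          ‖R‖ₑ = (essInfFiber s)⁻¹) ∧
      (IsFrame (waveletSystem ψ) ↔
        ∃ S s, IsFrameOperator (waveletSystem ψ) S ∧ HasFibers (dilationRep Kp Km u S) s ∧
          essSupFiber s < ∞ ∧ 0 < essInfFiber s) ∧
      (∀ S s, IsFrameOperator (waveletSystem ψ) S → HasFibers (dilationRep Kp Km u S) s →
        (IsFrame (waveletSystem ψ) ↔ essSupFiber s < ∞ ∧ 0 < essInfFiber s))) ∧
    -- Part 3
    (∀ B : ℝ, 0 < B →
      (IsTightFrame (waveletSystem ψ) B ↔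
        IsFrameOperator (waveletSystem ψ) ((B : ℂ) • ContinuousLinearMap.id ℂ L2R)) ∧
      (IsTightFrame (waveletSystem ψ) B ↔
        ∃ S, IsFrameOperator (waveletSystem ψ) S ∧
          HasFibers (dilationRep Kp Km u S)
            (fun _ => (B : ℂ) • ContinuousLinearMap.id ℂ (FiberSpace J)))) := by
  refine ⟨⟨isBessel_iff, fun S hS => ⟨fun f => by simpa using hS.comm_dilOp_zpow 1 f,
    isDecomposable_dilationRep Kp Km u hS.comm_dilOp_zpow, hS.isPositive, fun s hs => ?_⟩⟩,
    ⟨isFrame_iff, fun S R hS hSR hRS => ?_, ⟨fun h => ?_, ?_⟩,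
      fun S s hS hs => hS.isFrame_iff_fibers hs⟩, fun B hB => ?_⟩
  · have := separableSpace_of_hilbertBasis u
    have h := enorm_eq_essSupFiber hs
    refine ⟨hs.ae_isPositive (dilationRep_isPositive Kp Km u hS.isPositive), ?_, h, ?_⟩
    · rw [h, essSupFiber_eq]
    · rw [← h]; exact enorm_lt_top
  · have hR := inverse_comm_dilOp_zpow hS.comm_dilOp_zpow hSR hRS
    refine ⟨fun f => by simpa using hR 1 f, fun s hs => ?_⟩
    obtain ⟨h1, h2⟩ := ae_isUnit_and_hasFibers_inverse hR hSR hRS hs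
    exact ⟨h1, h2, enorm_eq_essSupFiber hs, enorm_inverse_eq_inv_essInfFiber hs hSR hRS⟩
  · obtain ⟨S, R, hS, -, -⟩ := isFrame_iff.1 h
    obtain ⟨s, hs⟩ := isDecomposable_dilationRep Kp Km u hS.comm_dilOp_zpow
    exact ⟨S, s, hS, hs, (hS.isFrame_iff_fibers hs).1 h⟩
  · rintro ⟨S, s, hS, hs, h⟩
    exact (hS.isFrame_iff_fibers hs).2 h
  · refine ⟨isTightFrame_iff hB, (isTightFrame_iff hB).trans ?_⟩
    -- Constant fibers `B` force `S = B • id`, which collapses the existential over `S`.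
    simp only [hasFibers_const_smul_id_iff, exists_eq_right]
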